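/- **Problem and algorithm.** Let $L,q_1,\dots,q_m:\mathbb R^p\to\mathbb R$ be continuously differentiable, let $\Theta=\{\theta: q_i(\theta)\le 0,\ i=1,\dots,m\}$ have non-empty interior, and let $\theta^*$ be the unique minimizer of $L$ over $\Theta$. Fix $a,c>0$, $A,\beta\ge 0$, real $\gamma$ and $\alpha\in(\tfrac12,1)$, and put $a_k=a/(k+1+A)^{\alpha}$, $c_k=c/(k+1)^{\gamma}$. The switch updating (SU) algorithm starts at a point $\tilde\theta_0\in\mathbb R^p$ and makes steps $t=0,1,2,\dots$ as follows. If $\tilde\theta_t\in\Theta$, it makes an SPSA step: if $k$ SPSA steps have been made before, it measures $y^{\pm}=L(\tilde\theta_t\pm c_k\Delta_k)+\varepsilon_k^{\pm}$, where $\Delta_k$ is a random vector in $\mathbb R^p$ and $\varepsilon_k^\pm$ are random errors, and sets $\tilde\theta_{t+1}=\tilde\theta_t-a_k\hat g_k$, where $\hat g_k$ has the components $(y^+-y^-)/(2c_k\Delta_{kj})$, $j=1,\dots,p$. If $\tilde\theta_t\notin\Theta$, it makes a constraint-gradient step $\tilde\theta_{t+1}=\tilde\theta_t-a_k\frac{(k+l+1)^\beta}{(k+2l+1)^\beta}\nabla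 q_i(\tilde\theta_t)$, where $i$ is the least index with $q_i(\tilde\theta_t)>0$, $l$ is the number of constraint-gradient steps made since the last SPSA step (or since the start), and $k$ is the index of the last SPSA step ($k=0$ if there was none). Write $\kappa(t)$ for the index $k$ used in step $t$ in either case. Let $h(\theta)=\nabla L(\theta)$ for $\theta\in\Theta$ and $h(\theta)=\nabla q_i(\theta)$ for $\theta\notin\Theta$, $i$ being the least index with $q_i(\theta)>0$. As $h$ is discontinuous, a solution of $dx/ds=-h(x)$ means an absolutely continuous $x$ with $-\dot x(s)\in\bigcap_{\delta>0}\overline{\mathrm{conv}}\,h(B(x(s),\delta))$ for almost every $s$. **Assumptions.** 1. $a_k,c_k>0$, $a_k\to0$, $c_k\to0$, $\sum_k a_k=\infty$, $\sum_k a_k^2/c_k^2<\infty$; almost surely, for every $t$ there is $t'$ with $\kappa(t+t')>\kappa(t)$. 2. The $\Delta_{kj}$ are i.i.d. over all $k$ and $j$ and symmetric about $0$; $\Delta_k$ is independent of the history $\mathcal H_k$ generated by $\Delta_j$ and $\varepsilon_j^+-\varepsilon_j^-$, $j<k$; $\mathbb E[\varepsilon_k^+-\varepsilon_k^-\mid\mathcal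 H_k,\Delta_k]=0$; and there are constants $\delta,\alpha_0,\dots,\alpha_4>0$ such that, for all $k,t,j$, $\mathbb E|\varepsilon_k^\pm|^{2+\delta}\le\alpha_0$, $\mathbb E\big[|L(\tilde\theta_t\pm c_{\kappa(t)}\Delta_{\kappa(t)})|^{2+\delta}\,\big|\,\tilde\theta_t\in\Theta\big]\le\alpha_1$ (whenever $\mathbb P(\tilde\theta_t\in\Theta)>0$), $|\Delta_{kj}|\le\alpha_2$ almost surely, $\mathbb E|\Delta_{kj}|^{-2-\delta}\le\alpha_3$ and $\mathbb E[(\varepsilon_k^\pm/\Delta_{kj})^2]\le\alpha_4$. 3. Almost surely $\sup_t\|\tilde\theta_t\|<\infty$. 4. $\theta^*$ is a solution of $dx/ds=-h(x)$ that is asymptotically stable in the sense of Lyapunov. 5. Let $D(\theta^*)$ be the set of initial values from which solutions on $[0,\infty)$ exist and from which all of them tend to $\theta^*$. There is a compact $S\subseteq D(\theta^*)$ such that, almost surely, $\tilde\theta_t\in S$ for infinitely many $t$. **Proposition.** Suppose that Assumptions 1–5 hold, that $\theta^*$ is a KKT point with Lagrange multipliers $\lambda_1,\dots,\lambda_m$,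 that is, $q_i(\theta^*)\le0$, $\lambda_i\ge0$ and $\lambda_iq_i(\theta^*)=0$ for all $i$, and $\nabla L(\theta^*)+\sum_{i=1}^m\lambda_i\nabla q_i(\theta^*)=0$, and that the gradients $\nabla q_i(\theta^*)$ of the active constraints ($q_i(\theta^*)=0$) are linearly independent (LICQ). Then, almost surely, the proportion of the steps that make loss function measurements converges: $$\lim_{t\to\infty}\frac{\#\{s<t:\ \tilde\theta_s\in\Theta\}}{t}=\frac{1}{1+\sum_{i=1}^m\lambda_i}.$$ -/

import Mathlib

open MeasureTheory ProbabilityTheory Filter Topology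
open scoped ENNReal

noncomputable section

namespace SwitchUpdating

/-- Real `p`-dimensional Euclidean space. -/
abbrev Vec (p : ℕ) : Type := EuclideanSpace ℝ (Fin p)

/-! ### The optimization problem -/

/-- The feasible region `Θ = {θ | q_i(θ) ≤ 0 for all i}`. -/
def feasible {p m : ℕ} (q : Fin m → Vec p → ℝ) : Set (Vec p) :=
  {θ | ∀ i, q i θ ≤ 0}

/-- `θs` is the unique solution of: minimize `L θ` subject to `q_i(θ) ≤ 0`. -/
def IsUniqueSolution {p m : ℕ} (L : Vec p → ℝ) (q : Fin m → Vec p → ℝ) (θs : Vec p) : Prop :=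
  θs ∈ feasible q ∧ ∀ θ ∈ feasible q, θ ≠ θs → L θs < L θ

/-- `θs` is a KKT point with Lagrange multipliers `lam`. -/
def IsKKTWith {p m : ℕ} (L : Vec p → ℝ) (q : Fin m → Vec p → ℝ) (θs : Vec p)
    (lam : Fin m → ℝ) : Prop :=
  (∀ i, q i θs ≤ 0) ∧ (∀ i, 0 ≤ lam i) ∧ (∀ i, lam i * q i θs = 0) ∧
    gradient L θs + ∑ i, lam i • gradient (q i) θs = 0

/-- Linear independence constraint qualification: the gradients of the active constraints are
linearly independent. -/
def LICQ {p m : ℕ} (q : Fin m → Vec p → ℝ) (θ : Vec p) : Prop :=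
  LinearIndependent ℝ (fun i : {i : Fin m // q i θ = 0} => gradient (q i.1) θ)

/-- `q_i` is the violated constraint of least index at `θ`. -/
def IsFirstViolated {p m : ℕ} (q : Fin m → Vec p → ℝ) (θ : Vec p) (i : Fin m) : Prop :=
  0 < q i θ ∧ ∀ j < i, q j θ ≤ 0

open Classical in
/-- The gradient at `θ` of the first violated constraint. At an infeasible point exactly one
summand is present. -/
def constraintGrad {p m : ℕ} (q : Fin m → Vec p → ℝ) (θ : Vec p) : Vec p :=
  ∑ i, if IsFirstViolated q θ i then gradient (q i) θ else 0

open Classical in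
/-- The (discontinuous) switching field `h`: the gradient of `L` at feasible points, the gradient
of the first violated constraint at infeasible points. -/
def switchField {p m : ℕ} (L : Vec p → ℝ) (q : Fin m → Vec p → ℝ) (θ : Vec p) : Vec p :=
  if θ ∈ feasible q then gradient L θ else constraintGrad q θ

/-! ### The differential equation `dx/ds = -h(x)` with discontinuous `h` -/

/-- Krasovskii regularization of a vector field: the intersection over `δ > 0` of the closed convex
hulls of `h (ball x δ)`. For continuous `h` it is `{h x}`. -/
def krasovskii {p : ℕ} (h : Vec p → Vec p) (x : Vec p) : Set (Vec p) :=
  ⋂ δ > (0 : ℝ), closure (convexHull ℝ (h '' Metric.ball x δ))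

/-- `x` is an absolutely continuous solution of `dx/ds = -h(x)` on `[0, T]`, in the generalized
sense `-dx/ds ∈ krasovskii h x` for almost every `s`. -/
def IsSolutionOn {p : ℕ} (h : Vec p → Vec p) (x : ℝ → Vec p) (T : ℝ) : Prop :=
  ∃ v : ℝ → Vec p, IntervalIntegrable v volume 0 T ∧
    (∀ᵐ s ∂(volume.restrict (Set.Icc (0 : ℝ) T)), v s ∈ krasovskii h (x s)) ∧
    ∀ s ∈ Set.Icc (0 : ℝ) T, x s = x 0 - ∫ r in (0 : ℝ)..s, v r

/-- `x` is a solution of `dx/ds = -h(x)` on `[0, ∞)`. -/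
def IsSolution {p : ℕ} (h : Vec p → Vec p) (x : ℝ → Vec p) : Prop :=
  ∀ T : ℝ, 0 ≤ T → IsSolutionOn h x T

/-- The domain of attraction of `θs`: the initial values from which solutions exist for all times
and all such solutions tend to `θs`. -/
def basin {p : ℕ} (h : Vec p → Vec p) (θs : Vec p) : Set (Vec p) :=
  {x₀ | (∃ x, IsSolution h x ∧ x 0 = x₀) ∧
    ∀ x, IsSolution h x → x 0 = x₀ → Tendsto x atTop (𝓝 θs)}

/-- `θs` is an asymptotically stable (in the sense of Lyapunov) solution of `dx/ds = -h(x)`. -/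
structure IsAsymptoticallyStable {p : ℕ} (h : Vec p → Vec p) (θs : Vec p) : Prop where
  equilibrium : IsSolution h (fun _ => θs)
  stable : ∀ ε > (0 : ℝ), ∃ δ > (0 : ℝ), ∀ T : ℝ, ∀ x : ℝ → Vec p, IsSolutionOn h x T →
    dist (x 0) θs < δ → ∀ s ∈ Set.Icc (0 : ℝ) T, dist (x s) θs < ε
  attractive : ∃ r > (0 : ℝ), Metric.ball θs r ⊆ basin h θs

/-! ### The switch updating (SU) algorithm -/

/-- All the data on which a run of the SU algorithm depends. `Δ k` is the random perturbation and
`εp k`, `εm k` are the errors of the two loss measurements made in the `k`-th SPSA step, so that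
these measurements are `L (θ ± c_k Δ_k) + ε_k^±`. -/
structure Data (p m : ℕ) (Ω : Type*) where
  L : Vec p → ℝ
  q : Fin m → Vec p → ℝ
  θ₀ : Vec p
  a : ℝ
  A : ℝ
  c : ℝ
  α : ℝ
  γ : ℝ
  β : ℝ
  Δ : ℕ → Ω → Vec p
  εp : ℕ → Ω → ℝ
  εm : ℕ → Ω → ℝ

/-- The state of the algorithm before a gradient-based step: the current point, the number of SPSA
steps made so far, and the counter `l` of the inner loop. -/
structure State (p : ℕ) where
  pt : Vec p
  count : ℕ
  inner : ℕ

namespace Data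

variable {p m : ℕ} {Ω : Type*}

/-- `a_k = a / (k + 1 + A) ^ α`. -/
def gainA (D : Data p m Ω) (k : ℕ) : ℝ := D.a / ((k : ℝ) + 1 + D.A) ^ D.α

/-- `c_k = c / (k + 1) ^ γ`. -/
def gainC (D : Data p m Ω) (k : ℕ) : ℝ := D.c / ((k : ℝ) + 1) ^ D.γ

/-- `a'_l(k, β) = a_k (k + l + 1) ^ β / (k + 2 l + 1) ^ β`. -/
def innerGain (D : Data p m Ω) (k l : ℕ) : ℝ :=
  D.gainA k * ((k : ℝ) + l + 1) ^ D.β / ((k : ℝ) + 2 * l + 1) ^ D.β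

/-- The simultaneous perturbation gradient estimate at `θ` in the `k`-th SPSA step. -/
def gradEstimate (D : Data p m Ω) (k : ℕ) (θ : Vec p) (ω : Ω) : Vec p :=
  WithLp.toLp 2 (fun j : Fin p =>
    ((D.L (θ + D.gainC k • D.Δ k ω) + D.εp k ω) - (D.L (θ - D.gainC k • D.Δ k ω) + D.εm k ω)) /
      (2 * D.gainC k * D.Δ k ω j))

open Classical in
/-- The value at the given state of the iteration counter `k` of the algorithm: `k` is increased
only when a feasible point has been reached again after an SPSA step, so in the inner loop it is
the index of the last SPSA step (and it is `0` before the first one). -/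
def counter (D : Data p m Ω) (s : State p) : ℕ :=
  if s.pt ∈ feasible D.q then s.count else s.count - 1

open Classical in
/-- One gradient-based step: an SPSA step at a feasible point, a gradient step on the first violated
constraint at an infeasible point. -/
def step (D : Data p m Ω) (ω : Ω) (s : State p) : State p :=
  if s.pt ∈ feasible D.q then
    { pt := s.pt - D.gainA (D.counter s) • D.gradEstimate (D.counter s) s.pt ω
      count := s.count + 1
      inner := 0 }
  else
    { pt := s.pt - D.innerGain (D.counter s) s.inner • constraintGrad D.q s.pt
      count := s.count
      inner := s.inner + 1 }

/-- The state before the `t`-th gradient-based step. -/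
def state (D : Data p m Ω) (ω : Ω) : ℕ → State p
  | 0 => { pt := D.θ₀, count := 0, inner := 0 }
  | t + 1 => D.step ω (D.state ω t)

/-- The iterate before the `t`-th gradient-based step (steps of both kinds are counted). -/
def iterate (D : Data p m Ω) (t : ℕ) (ω : Ω) : Vec p := (D.state ω t).pt

/-- The value `κ(t)` of the iteration counter `k` at the `t`-th gradient-based step. -/
def kappa (D : Data p m Ω) (t : ℕ) (ω : Ω) : ℕ := D.counter (D.state ω t)

open Classical in
/-- The proportion, among the first `t` gradient-based steps, of the steps that make loss function
measurements, i.e. of the steps taken at feasible points. -/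
def measurementProportion (D : Data p m Ω) (t : ℕ) (ω : Ω) : ℝ :=
  (((Finset.range t).filter (fun s => D.iterate s ω ∈ feasible D.q)).card : ℝ) / (t : ℝ)

/-- The history before the `k`-th SPSA step. A run up to that step depends on the noise only through
the differences `ε_j^+ - ε_j^-`, `j < k`, and these are determined by the perturbations and the
iterates; so this is the information in the iterates up to that step and in `Δ_0, …, Δ_{k-1}`. -/
@[reducible] def history (D : Data p m Ω) (k : ℕ) : MeasurableSpace Ω :=
  ⨆ j : Fin k, (MeasurableSpace.comap (D.Δ j) inferInstance ⊔
    MeasurableSpace.comap (fun ω => D.εp j ω - D.εm j ω) inferInstance)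

/-- Standing requirements on the problem and on the parameters of the algorithm. -/
structure Standing [MeasurableSpace Ω] (D : Data p m Ω) : Prop where
  contDiff_L : ContDiff ℝ 1 D.L
  contDiff_q : ∀ i, ContDiff ℝ 1 (D.q i)
  interior_nonempty : (interior (feasible D.q)).Nonempty
  a_pos : 0 < D.a
  A_nonneg : 0 ≤ D.A
  c_pos : 0 < D.c
  β_nonneg : 0 ≤ D.β
  measurable_Δ : ∀ k, Measurable (D.Δ k)
  measurable_εp : ∀ k, Measurable (D.εp k)
  measurable_εm : ∀ k, Measurable (D.εm k)

/-- Conditions on the gain sequences; the feasible region is reached again and again. -/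
structure GainCondition [MeasurableSpace Ω] (D : Data p m Ω) (μ : Measure Ω) : Prop where
  gainA_pos : ∀ k, 0 < D.gainA k
  gainC_pos : ∀ k, 0 < D.gainC k
  gainA_tendsto : Tendsto D.gainA atTop (𝓝 0)
  gainC_tendsto : Tendsto D.gainC atTop (𝓝 0)
  sum_gainA : Tendsto (fun n => ∑ k ∈ Finset.range n, D.gainA k) atTop atTop
  summable_sq : Summable (fun k => D.gainA k ^ 2 / D.gainC k ^ 2)
  returns : ∀ᵐ ω ∂μ, ∀ t, ∃ t', D.kappa t ω < D.kappa (t + t') ω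

/-- The perturbations are i.i.d. (over steps and coordinates), symmetric, and freshly sampled in
each SPSA step. -/
structure PerturbationCondition [MeasurableSpace Ω] (D : Data p m Ω) (μ : Measure Ω) : Prop where
  indep : iIndepFun (fun (kj : ℕ × Fin p) (ω : Ω) => D.Δ kj.1 ω kj.2) μ
  ident : ∀ k k' : ℕ, ∀ j j' : Fin p,
    IdentDistrib (fun ω => D.Δ k ω j) (fun ω => D.Δ k' ω j') μ μ
  symm : ∀ k : ℕ, ∀ j : Fin p, IdentDistrib (fun ω => D.Δ k ω j) (fun ω => -(D.Δ k ω j)) μ μ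
  fresh : ∀ k, Indep (MeasurableSpace.comap (D.Δ k) inferInstance) (D.history k) μ

/-- The difference of the two measurement errors of an SPSA step has conditional mean zero given the
history and the perturbation of that step. -/
def NoiseCentered [MeasurableSpace Ω] (D : Data p m Ω) (μ : Measure Ω) : Prop :=
  ∀ k, μ[fun ω => D.εp k ω - D.εm k ω |
    D.history k ⊔ MeasurableSpace.comap (D.Δ k) inferInstance] =ᵐ[μ] 0

/-- Moment conditions on the noise, the loss values and the perturbations. -/
def MomentCondition [MeasurableSpace Ω] (D : Data p m Ω) (μ : Measure Ω) : Prop :=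
  ∃ δ α₀ α₁ α₂ α₃ α₄ : ℝ, 0 < δ ∧ 0 < α₀ ∧ 0 < α₁ ∧ 0 < α₂ ∧ 0 < α₃ ∧ 0 < α₄ ∧
    (∀ k, ∫⁻ ω, ‖D.εp k ω‖ₑ ^ (2 + δ) ∂μ ≤ ENNReal.ofReal α₀ ∧
      ∫⁻ ω, ‖D.εm k ω‖ₑ ^ (2 + δ) ∂μ ≤ ENNReal.ofReal α₀) ∧
    (∀ t,
      ∫⁻ ω, ‖D.L (D.iterate t ω + D.gainC (D.kappa t ω) • D.Δ (D.kappa t ω) ω)‖ₑ ^ (2 + δ)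
        ∂(cond μ {ω | D.iterate t ω ∈ feasible D.q}) ≤ ENNReal.ofReal α₁ ∧
      ∫⁻ ω, ‖D.L (D.iterate t ω - D.gainC (D.kappa t ω) • D.Δ (D.kappa t ω) ω)‖ₑ ^ (2 + δ)
        ∂(cond μ {ω | D.iterate t ω ∈ feasible D.q}) ≤ ENNReal.ofReal α₁) ∧
    (∀ k, ∀ j : Fin p, ∀ᵐ ω ∂μ, |D.Δ k ω j| ≤ α₂) ∧
    (∀ k, ∀ j : Fin p, ∫⁻ ω, ‖D.Δ k ω j‖ₑ ^ (-(2 + δ)) ∂μ ≤ ENNReal.ofReal α₃) ∧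
    (∀ k, ∀ j : Fin p, ∫⁻ ω, ‖D.εp k ω / D.Δ k ω j‖ₑ ^ (2 : ℝ) ∂μ ≤ ENNReal.ofReal α₄ ∧
      ∫⁻ ω, ‖D.εm k ω / D.Δ k ω j‖ₑ ^ (2 : ℝ) ∂μ ≤ ENNReal.ofReal α₄)

/-- Almost surely, the sequence of iterates is bounded. -/
def BoundedIterates [MeasurableSpace Ω] (D : Data p m Ω) (μ : Measure Ω) : Prop :=
  ∀ᵐ ω ∂μ, ∃ R : ℝ, ∀ t, ‖D.iterate t ω‖ ≤ R

/-- Almost surely, the iterates are infinitely often in a fixed compact subset of the domain of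
attraction of `θs`. -/
def RecurrentInBasin [MeasurableSpace Ω] (D : Data p m Ω) (μ : Measure Ω) (θs : Vec p) : Prop :=
  ∃ S : Set (Vec p), IsCompact S ∧ S ⊆ basin (switchField D.L D.q) θs ∧
    ∀ᵐ ω ∂μ, ∃ᶠ t in atTop, D.iterate t ω ∈ S

end Data

end SwitchUpdating

end

/-! The proof has a convergence half and a counting half, joined by the notion of a perturbed Euler
scheme.

Convergence. In the clock that advances by the gain of each step, a run is an Euler scheme for
$dx/ds=-h(x)$ whose perturbations are the weighted errors of the gradient estimates. These errors
are negligible over late windows (`ae_negligibleSum`): cross terms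
$\partial_iL\,\Delta_{ki}/\Delta_{kj}$ and measurement noise form $L^2$-bounded martingales, and the
bias of the difference quotient tends to zero. Limits of the time-shifted scheme along an
ultrafilter are Lipschitz, and their difference quotients are limits of averages of nearby values of
$h$, so they solve the Krasovskii inclusion (`isSolution_limitPath`). Recurrence and asymptotic
stability then force the iterates to converge to $\theta^*$ (`tendsto_equilibrium`).

Counting. LICQ gives a linear functional $\varphi$ equal to 1 on all active constraint gradients. By
the KKT equation $\varphi(\nabla L(\theta^*))=-\Lambda$ with $\Lambda=\sum\lambda_i$, so along the
run $\varphi(h)$ is asymptotically $y_t=1-(1+\Lambda)\mathbf 1\{\tilde\theta_t\in\Theta\}$. The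
gain-weighted sum of $h$ telescopes to a bounded quantity plus a negligible one; hence the
gain-weighted sum of $y$ is small compared to the clock.

Removing the weights takes three observations. The clock is comparable to $\sum_{k<K}a_k$, where $K$
counts SPSA steps. A long inner loop would push the weighted sum of $y$ up too far, so its length is
$o(K)$ and the inner gains are asymptotically $a_k$. Finally $a_{\kappa(t)}$ is decreasing and
$\sum_{k<K}a_k=O(Ka_K)$ because $\alpha<1$, so partial summation gives $\sum_{s<t}y_s=o(t)$, that
is, $K/t\to1/(1+\Lambda)$. -/

noncomputable section

namespace SwitchUpdating

/-! ### Negligible perturbations -/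

/-- The partial sums of `ζ` over late windows are small relative to the length of the window,
measured by the gains `a`. -/
def NegligibleSum {E : Type*} [NormedAddCommGroup E] (a : ℕ → ℝ) (ζ : ℕ → E) : Prop :=
  ∀ ε > (0 : ℝ), ∃ n₀ : ℕ, ∀ n ≥ n₀, ∀ m ≥ n,
    ‖∑ k ∈ Finset.Ico n m, ζ k‖ ≤ ε * (1 + ∑ k ∈ Finset.Ico n m, a k)

/-- The time elapsed before step `n` when step `k` takes time `γ k`. -/
def clock (γ : ℕ → ℝ) (n : ℕ) : ℝ := ∑ k ∈ Finset.range n, γ k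

lemma sum_Ico_eq_clock_sub (γ : ℕ → ℝ) {n m : ℕ} (h : n ≤ m) :
    ∑ k ∈ Finset.Ico n m, γ k = clock γ m - clock γ n :=
  Finset.sum_Ico_eq_sub _ h

lemma clock_mono {γ : ℕ → ℝ} (hγ : ∀ t, 0 < γ t) : Monotone (clock γ) := by
  refine monotone_nat_of_le_succ fun n => ?_
  rw [clock, clock, Finset.sum_range_succ]
  linarith [hγ n]

/-- `θ` is an Euler scheme for `dx/ds = -h(x)` with step sizes `γ` and perturbations `ζ`. -/
structure PerturbedEuler {p : ℕ} (h : Vec p → Vec p) (θ ζ : ℕ → Vec p) (γ : ℕ → ℝ) (C : ℝ) :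
    Prop where
  step : ∀ t, θ (t + 1) = θ t - γ t • h (θ t) - ζ t
  pos : ∀ t, 0 < γ t
  tendsto_zero : Tendsto γ atTop (𝓝 0)
  diverges : Tendsto (clock γ) atTop atTop
  negligible : NegligibleSum γ ζ
  field_le : ∀ t, ‖h (θ t)‖ ≤ C

/-- The first step index, not before `t`, at which time `s` has elapsed since step `t`. -/
def timeIndex (γ : ℕ → ℝ) (t : ℕ) (s : ℝ) : ℕ := sInf {j | t ≤ j ∧ s ≤ clock γ j - clock γ t}

/-! ### Increments and clock of a perturbed Euler scheme -/

namespace PerturbedEuler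

variable {p : ℕ} {h : Vec p → Vec p} {θ ζ : ℕ → Vec p} {γ : ℕ → ℝ} {C : ℝ}

lemma sub_eq (H : PerturbedEuler h θ ζ γ C) {n m : ℕ} (hnm : n ≤ m) :
    ∑ k ∈ Finset.Ico n m, γ k • h (θ k) = θ n - θ m - ∑ k ∈ Finset.Ico n m, ζ k := by
  induction m, hnm using Nat.le_induction with
  | base => simp
  | succ m hm ih =>
    rw [Finset.sum_Ico_succ_top hm, Finset.sum_Ico_succ_top hm, ih, H.step]
    abel

/-- The drift moves the scheme at speed at most `C`; the perturbation adds a fixed error and,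
through the second term of `NegligibleSum`, at most unit speed. -/
lemma norm_sub_le (H : PerturbedEuler h θ ζ γ C) {ε : ℝ} (hε : 0 < ε) :
    ∃ n₀ : ℕ, ∀ n ≥ n₀, ∀ m ≥ n, ‖θ m - θ n‖ ≤ (C + 1) * (clock γ m - clock γ n) + ε := by
  -- The minimum bounds the constant part by `ε` and the part proportional to time by `1`.
  obtain ⟨n₀, hn₀⟩ := H.negligible (min ε 1) (by positivity)
  refine ⟨n₀, fun n hn m hm => ?_⟩
  have h1 := hn₀ n hn m hm
  have h2 : ‖∑ k ∈ Finset.Ico n m, γ k • h (θ k)‖ ≤ C * (clock γ m - clock γ n) := by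
    rw [← sum_Ico_eq_clock_sub γ hm, Finset.mul_sum]
    refine norm_sum_le_of_le _ fun k _ => ?_
    rw [norm_smul, Real.norm_of_nonneg (H.pos k).le, mul_comm]
    exact mul_le_mul_of_nonneg_right (H.field_le k) (H.pos k).le
  have h3 : θ m - θ n = -(∑ k ∈ Finset.Ico n m, γ k • h (θ k)) - ∑ k ∈ Finset.Ico n m, ζ k := by
    rw [H.sub_eq hm]; abel
  rw [sum_Ico_eq_clock_sub γ hm] at h1
  have h4 := clock_mono H.pos hm
  have h5 : min ε 1 * (1 + (clock γ m - clock γ n)) ≤ ε + (clock γ m - clock γ n) := by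
    have a1 := min_le_left ε 1
    have a2 := mul_le_mul_of_nonneg_right (min_le_right ε 1) (sub_nonneg.2 h4)
    linarith
  rw [h3]
  refine (_root_.norm_sub_le _ _).trans ?_
  rw [norm_neg]
  linarith

lemma timeIndex_spec (H : PerturbedEuler h θ ζ γ C) (t : ℕ) (s : ℝ) :
    t ≤ timeIndex γ t s ∧ s ≤ clock γ (timeIndex γ t s) - clock γ t := by
  refine Nat.sInf_mem (s := {j | t ≤ j ∧ s ≤ clock γ j - clock γ t}) ?_
  obtain ⟨j, h1, h2⟩ := ((eventually_ge_atTop t).and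
    (H.diverges.eventually_ge_atTop (s + clock γ t))).exists
  exact ⟨j, h1, by linarith⟩

lemma timeIndex_le {t j : ℕ} {s : ℝ} (h1 : t ≤ j) (h2 : s ≤ clock γ j - clock γ t) :
    timeIndex γ t s ≤ j :=
  Nat.sInf_le ⟨h1, h2⟩

lemma timeIndex_mono (H : PerturbedEuler h θ ζ γ C) (t : ℕ) : Monotone (timeIndex γ t) :=
  fun _ s' hs => timeIndex_le (H.timeIndex_spec t s').1 (hs.trans (H.timeIndex_spec t s').2)

/-- By minimality of the index the overshoot beyond `s` is less than the last gain, which tends to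
zero. For `s ≤ 0` the index is `t` itself, whence the `max`. -/
lemma tendsto_elapsed (H : PerturbedEuler h θ ζ γ C) (s : ℝ) :
    Tendsto (fun t => clock γ (timeIndex γ t s) - clock γ t) atTop (𝓝 (max s 0)) := by
  rw [Metric.tendsto_atTop]
  intro ε hε
  obtain ⟨n₀, hn₀⟩ := eventually_atTop.1 (H.tendsto_zero.eventually_lt_const hε)
  refine ⟨n₀, fun t ht => ?_⟩
  obtain ⟨h1, h2⟩ := H.timeIndex_spec t s
  have h3 := clock_mono H.pos h1
  have h4 : clock γ (timeIndex γ t s) - clock γ t < max s 0 + ε := by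
    rcases h1.eq_or_lt with h5 | h5
    · rw [← h5, sub_self]
      have := le_max_right s 0
      linarith
    · obtain ⟨j, hj⟩ : ∃ j, timeIndex γ t s = j + 1 := ⟨timeIndex γ t s - 1, by omega⟩
      have h6 : clock γ j - clock γ t < s := by
        by_contra! h7
        have := timeIndex_le (by omega) h7
        omega
      have h8 : clock γ (j + 1) = clock γ j + γ j := Finset.sum_range_succ _ _
      have := hn₀ j (by omega)
      have := le_max_left s 0
      rw [hj, h8]
      linarith
  rw [Real.dist_eq, abs_lt]
  constructor
  · have := max_le h2 (sub_nonneg.2 h3)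
    linarith
  · linarith

lemma tendsto_timeIndex (H : PerturbedEuler h θ ζ γ C) (s : ℝ) :
    Tendsto (fun t => timeIndex γ t s) atTop atTop :=
  tendsto_atTop_mono (fun t => (H.timeIndex_spec t s).1) tendsto_id

/-! ### Limit paths of the time-shifted scheme -/

variable {𝒰 : Ultrafilter ℕ} {x : ℝ → Vec p}

/-- `x` is the limit along `𝒰` of the time-shifted interpolations of `θ`. -/
def IsLimitPath (γ : ℕ → ℝ) (θ : ℕ → Vec p) (𝒰 : Ultrafilter ℕ) (x : ℝ → Vec p) : Prop :=
  ∀ s, Tendsto (fun t => θ (timeIndex γ t s)) 𝒰 (𝓝 (x s))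

/-- Bounded sequences converge along an ultrafilter, so one ultrafilter serves all times at once and
no subsequences are extracted. -/
lemma exists_isLimitPath {R : ℝ} (hR : ∀ t, ‖θ t‖ ≤ R) (γ : ℕ → ℝ) (𝒰 : Ultrafilter ℕ) :
    ∃ x, IsLimitPath γ θ 𝒰 x := by
  have key : ∀ s, ∃ y, Tendsto (fun t => θ (timeIndex γ t s)) 𝒰 (𝓝 y) := by
    intro s
    obtain ⟨y, -, hy⟩ := (isCompact_closedBall (0 : Vec p) R).ultrafilter_le_nhds
      (𝒰.map fun t => θ (timeIndex γ t s)) (by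
        rw [le_principal_iff]
        exact mem_map.2 (Eventually.of_forall fun t => by simpa using hR _))
    exact ⟨y, hy⟩
  choose x hx using key
  exact ⟨x, hx⟩

/-- The additive error in `norm_sub_le` is arbitrarily small at late steps and vanishes in the
limit, which makes the limit path Lipschitz. -/
lemma norm_limitPath_sub_le (H : PerturbedEuler h θ ζ γ C) (h𝒰 : (𝒰 : Filter ℕ) ≤ atTop)
    (hx : IsLimitPath γ θ 𝒰 x) {s s' : ℝ} (hs : s ≤ s') :
    ‖x s' - x s‖ ≤ (C + 1) * (max s' 0 - max s 0) := by
  refine le_of_forall_pos_le_add fun ε hε => ?_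
  obtain ⟨n₀, hn₀⟩ := H.norm_sub_le hε
  have h1 : Tendsto (fun t => (C + 1) * (clock γ (timeIndex γ t s') - clock γ t -
      (clock γ (timeIndex γ t s) - clock γ t)) + ε) 𝒰
      (𝓝 ((C + 1) * (max s' 0 - max s 0) + ε)) :=
    ((((H.tendsto_elapsed s').mono_left h𝒰).sub ((H.tendsto_elapsed s).mono_left h𝒰)).const_mul
      _).add_const _
  refine le_of_tendsto_of_tendsto ((hx s').sub (hx s)).norm h1 ?_
  filter_upwards [h𝒰 (eventually_ge_atTop n₀)] with t ht
  have := hn₀ _ (ht.trans (H.timeIndex_spec t s).1) _ (H.timeIndex_mono t hs)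
  refine this.trans (le_of_eq ?_)
  ring

lemma C_nonneg (H : PerturbedEuler h θ ζ γ C) : 0 ≤ C := (norm_nonneg _).trans (H.field_le 0)

lemma lipschitzWith_limitPath (H : PerturbedEuler h θ ζ γ C) (h𝒰 : (𝒰 : Filter ℕ) ≤ atTop)
    (hx : IsLimitPath γ θ 𝒰 x) : LipschitzWith (Real.toNNReal (C + 1)) x := by
  have hC := H.C_nonneg
  have key : ∀ s s' : ℝ, s ≤ s' → dist (x s') (x s) ≤ (C + 1) * dist s' s := by
    intro s s' hs
    rw [dist_eq_norm, Real.dist_eq, abs_of_nonneg (sub_nonneg.2 hs)]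
    refine (H.norm_limitPath_sub_le h𝒰 hx hs).trans ?_
    refine mul_le_mul_of_nonneg_left ?_ (by linarith)
    rcases max_cases s' 0 with h1 | h1 <;> rcases max_cases s 0 with h2 | h2 <;> linarith
  refine LipschitzWith.of_dist_le_mul fun s s' => ?_
  rw [Real.coe_toNNReal _ (by linarith)]
  rcases le_total s s' with hs | hs
  · rw [dist_comm (x s), dist_comm s]; exact key _ _ hs
  · exact key _ _ hs

lemma tendsto_sum_perturbation (H : PerturbedEuler h θ ζ γ C) (h𝒰 : (𝒰 : Filter ℕ) ≤ atTop)
    {s s' : ℝ} (hs : s ≤ s') :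
    Tendsto (fun t => ∑ k ∈ Finset.Ico (timeIndex γ t s) (timeIndex γ t s'), ζ k) 𝒰 (𝓝 0) := by
  have h1 : Tendsto (fun t => clock γ (timeIndex γ t s') - clock γ t -
      (clock γ (timeIndex γ t s) - clock γ t)) 𝒰 (𝓝 (max s' 0 - max s 0)) :=
    ((H.tendsto_elapsed s').mono_left h𝒰).sub ((H.tendsto_elapsed s).mono_left h𝒰)
  rw [Metric.tendsto_nhds]
  intro ε hε
  -- Eventually `B` exceeds the duration of the window.
  set B := max s' 0 - max s 0 + 1 with hB
  have hB0 : 0 < B := by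
    have := max_le_max_right (0 : ℝ) hs
    linarith
  obtain ⟨n₀, hn₀⟩ := H.negligible (ε / (2 * (1 + B))) (by positivity)
  filter_upwards [h𝒰 (eventually_ge_atTop n₀),
    h1.eventually_lt_const (show _ < B by linarith)] with t ht hB'
  rw [dist_zero_right]
  refine (hn₀ _ (ht.trans (H.timeIndex_spec t s).1) _ (H.timeIndex_mono t hs)).trans_lt ?_
  rw [sum_Ico_eq_clock_sub γ (H.timeIndex_mono t hs)]
  calc _ ≤ ε / (2 * (1 + B)) * (1 + B) := by
        refine mul_le_mul_of_nonneg_left ?_ (by positivity)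
        linarith
    _ = ε / 2 := by field_simp
    _ < ε := by linarith

/-- Difference quotients of a limit path lie in the closed convex hull of nearby values of the
field. -/
lemma slope_limitPath_mem (H : PerturbedEuler h θ ζ γ C) (h𝒰 : (𝒰 : Filter ℕ) ≤ atTop)
    (hx : IsLimitPath γ θ 𝒰 x) {s η δ : ℝ} (hs : 0 ≤ s) (hη : 0 < η) (hδ : (C + 1) * η < δ) :
    -(η⁻¹ • (x (s + η) - x s)) ∈ closure (convexHull ℝ (h '' Metric.ball (x s) δ)) := by
  have e1 := (H.tendsto_elapsed s).mono_left h𝒰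
  have e2 := (H.tendsto_elapsed (s + η)).mono_left h𝒰
  rw [max_eq_left hs] at e1
  rw [max_eq_left (by linarith)] at e2
  have e3 : Tendsto (fun t => clock γ (timeIndex γ t (s + η)) - clock γ (timeIndex γ t s)) 𝒰
      (𝓝 η) := by
    have := e2.sub e1
    simp only [sub_sub_sub_cancel_right, add_sub_cancel_left] at this
    exact this
  have e4 := ((hx s).sub (hx (s + η))).sub
    (H.tendsto_sum_perturbation h𝒰 (show s ≤ s + η by linarith))
  have e5 := (e3.inv₀ hη.ne').smul e4
  have e6 : η⁻¹ • (x s - x (s + η) - 0) = -(η⁻¹ • (x (s + η) - x s)) := by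
    rw [sub_zero, ← smul_neg, neg_sub]
  rw [e6] at e5
  refine mem_closure_of_tendsto e5 ?_
  -- The slack is spent three times: on the duration of the window, on the error in `norm_sub_le`,
  -- and on the distance from the first point of the window to `x s`.
  obtain ⟨ε, hε, hε'⟩ : ∃ ε > 0, (C + 1) * η + 3 * ε < δ :=
    ⟨(δ - (C + 1) * η) / 6, by linarith, by linarith⟩
  obtain ⟨n₀, hn₀⟩ := H.norm_sub_le hε
  have e7 : ∀ᶠ t in (𝒰 : Filter ℕ), (C + 1) * (clock γ (timeIndex γ t (s + η)) -
      clock γ (timeIndex γ t s)) < (C + 1) * η + ε :=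
    (e3.const_mul (C + 1)).eventually_lt_const (by linarith)
  filter_upwards [h𝒰 (eventually_ge_atTop n₀), e3.eventually_const_lt hη, e7,
    (Metric.tendsto_nhds.1 (hx s)) ε hε] with t ht hpos hlt hd
  have hle := H.timeIndex_mono t (show s ≤ s + η by linarith)
  -- The quotient is now the center of mass of the values of `h` in the window, with the gains as
  -- weights.
  rw [← H.sub_eq hle, ← sum_Ico_eq_clock_sub γ hle]
  rw [← sum_Ico_eq_clock_sub γ hle] at hpos
  refine Finset.centerMass_mem_convexHull (Finset.Ico _ _) (fun k _ => (H.pos k).le) hpos ?_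
  intro k hk
  refine ⟨θ k, ?_, rfl⟩
  rw [Finset.mem_Ico] at hk
  have h1 := hn₀ _ (ht.trans (H.timeIndex_spec t s).1) k hk.1
  have h2 := clock_mono H.pos hk.2.le
  have h3 : (C + 1) * (clock γ k - clock γ (timeIndex γ t s)) ≤
      (C + 1) * (clock γ (timeIndex γ t (s + η)) - clock γ (timeIndex γ t s)) :=
    mul_le_mul_of_nonneg_left (by linarith) (by linarith [H.C_nonneg])
  rw [Metric.mem_ball]
  refine (dist_triangle _ (θ (timeIndex γ t s)) _).trans_lt ?_
  rw [dist_eq_norm]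
  linarith

/-- For each `δ` the slopes over durations below `δ / (C + 1)` lie in one closed set, which
therefore contains their limit. -/
lemma neg_deriv_limitPath_mem (H : PerturbedEuler h θ ζ γ C) (h𝒰 : (𝒰 : Filter ℕ) ≤ atTop)
    (hx : IsLimitPath γ θ 𝒰 x) {s : ℝ} (hs : 0 ≤ s) (hd : DifferentiableAt ℝ x s) :
    -deriv x s ∈ krasovskii h (x s) := by
  rw [krasovskii, Set.mem_iInter₂]
  intro δ hδ
  refine isClosed_closure.mem_of_tendsto (b := 𝓝[>] (0 : ℝ))
    hd.hasDerivAt.tendsto_slope_zero_right.neg ?_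
  have hC := H.C_nonneg
  have : Set.Ioo (0 : ℝ) (δ / (C + 1)) ∈ 𝓝[>] (0 : ℝ) := Ioo_mem_nhdsGT (by positivity)
  filter_upwards [this] with η hη
  refine H.slope_limitPath_mem h𝒰 hx hs hη.1 ?_
  have := (lt_div_iff₀ (by linarith)).1 hη.2
  linarith

end PerturbedEuler

/-! ### Limit paths solve the differential inclusion -/

lemma intervalIntegrable_deriv_of_lipschitz {p : ℕ} {K : NNReal} {x : ℝ → Vec p}
    (hx : LipschitzWith K x) (a b : ℝ) : IntervalIntegrable (deriv x) volume a b := by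
  refine (intervalIntegrable_const (c := (K : ℝ))).mono_fun
    (stronglyMeasurable_deriv x).aestronglyMeasurable (Eventually.of_forall fun s => ?_)
  change ‖deriv x s‖ ≤ ‖(K : ℝ)‖
  rw [Real.norm_of_nonneg K.coe_nonneg]
  exact norm_deriv_le_of_lipschitz hx

/-- The fundamental theorem of calculus for Lipschitz paths in Euclidean space. -/
lemma integral_deriv_of_lipschitz {p : ℕ} {K : NNReal} {x : ℝ → Vec p}
    (hx : LipschitzWith K x) (a b : ℝ) : ∫ s in a..b, deriv x s = x b - x a := by
  -- Coordinates are real Lipschitz functions, hence absolutely continuous.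
  ext j
  let P : Vec p →L[ℝ] ℝ := EuclideanSpace.proj j
  have h1 : P (∫ s in a..b, deriv x s) = ∫ s in a..b, P (deriv x s) :=
    (P.intervalIntegral_comp_comm (intervalIntegrable_deriv_of_lipschitz hx a b)).symm
  have h2 : LipschitzWith (‖P‖₊ * K) (fun s => P (x s)) := P.lipschitz.comp hx
  have h3 := (h2.lipschitzOnWith (s := Set.uIcc a b)).absolutelyContinuousOnInterval
    |>.integral_deriv_eq_sub
  have h4 : ∫ s in a..b, P (deriv x s) = ∫ s in a..b, deriv (fun s => P (x s)) s := by
    refine intervalIntegral.integral_congr_ae ?_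
    filter_upwards [hx.ae_differentiableAt (μ := volume)] with s hs _
    exact (P.hasFDerivAt.comp_hasDerivAt s hs.hasDerivAt).deriv.symm
  change P (∫ s in a..b, deriv x s) = P (x b - x a)
  rw [h1, h4, h3, map_sub]

/-- A Lipschitz path is differentiable almost everywhere and is the integral of its derivative, so
the pointwise inclusion suffices. -/
lemma PerturbedEuler.isSolution_limitPath {p : ℕ} {h : Vec p → Vec p} {θ ζ : ℕ → Vec p}
    {γ : ℕ → ℝ} {C : ℝ} {𝒰 : Ultrafilter ℕ} {x : ℝ → Vec p}
    (H : PerturbedEuler h θ ζ γ C) (h𝒰 : (𝒰 : Filter ℕ) ≤ atTop)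
    (hx : IsLimitPath γ θ 𝒰 x) : IsSolution h x := by
  intro T _
  have hL := H.lipschitzWith_limitPath h𝒰 hx
  refine ⟨fun s => -deriv x s, (intervalIntegrable_deriv_of_lipschitz hL 0 T).neg, ?_, ?_⟩
  · rw [ae_restrict_iff' measurableSet_Icc]
    filter_upwards [hL.ae_differentiableAt (μ := volume)] with s hs hsT
    exact H.neg_deriv_limitPath_mem h𝒰 hx hsT.1 hs
  · intro s _
    rw [intervalIntegral.integral_neg, integral_deriv_of_lipschitz hL]
    abel

/-! ### Convergence to an asymptotically stable equilibrium -/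

namespace PerturbedEuler

variable {p : ℕ} {h : Vec p → Vec p} {θ ζ : ℕ → Vec p} {γ : ℕ → ℝ} {C : ℝ}

/-- Lets limit paths start at the times with a property that holds only infinitely often. -/
lemma exists_ultrafilter {P : ℕ → Prop} (hP : ∃ᶠ t in atTop, P t) :
    ∃ 𝒰 : Ultrafilter ℕ, (𝒰 : Filter ℕ) ≤ atTop ∧ ∀ᶠ t in (𝒰 : Filter ℕ), P t := by
  have : (atTop ⊓ 𝓟 {t | P t} : Filter ℕ).NeBot := frequently_mem_iff_neBot.1 hP
  refine ⟨Ultrafilter.of (atTop ⊓ 𝓟 {t | P t}), (Ultrafilter.of_le _).trans inf_le_left, ?_⟩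
  exact (le_principal_iff.1 ((Ultrafilter.of_le _).trans inf_le_right))

/-- An Euler scheme that is infinitely often in a compact subset of the basin comes infinitely often
close to the equilibrium. -/
lemma frequently_dist_lt (H : PerturbedEuler h θ ζ γ C) {R : ℝ} (hR : ∀ t, ‖θ t‖ ≤ R)
    {θs : Vec p} {S : Set (Vec p)} (hS : IsCompact S) (hSb : S ⊆ basin h θs)
    (hrec : ∃ᶠ t in atTop, θ t ∈ S) {δ : ℝ} (hδ : 0 < δ) :
    ∃ᶠ t in atTop, dist (θ t) θs < δ := by
  obtain ⟨𝒰, h𝒰, h𝒰S⟩ := exists_ultrafilter hrec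
  obtain ⟨x, hx⟩ := exists_isLimitPath hR γ 𝒰
  have h0 : ∀ t, timeIndex γ t 0 = t := fun t =>
    le_antisymm (timeIndex_le le_rfl (by simp)) (H.timeIndex_spec t 0).1
  have hx0 : x 0 ∈ S := by
    refine hS.isClosed.mem_of_tendsto (hx 0) ?_
    simpa only [h0] using h𝒰S
  -- The limit path starts in the basin, so it is `δ`-close to `θs` at some time `T`; the scheme at
  -- elapsed time `T` is then close as well.
  have hlim := (hSb hx0).2 x (H.isSolution_limitPath h𝒰 hx) rfl
  obtain ⟨T, hT⟩ := (Metric.tendsto_nhds.1 hlim δ hδ).exists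
  have h1 : ∀ᶠ t in (𝒰 : Filter ℕ), dist (θ (timeIndex γ t T)) θs < δ :=
    ((hx T).dist tendsto_const_nhds).eventually_lt_const hT
  exact ((H.tendsto_timeIndex T).mono_left h𝒰).frequently h1.frequently

/-- Convergence of a recurrent perturbed Euler scheme to an asymptotically stable equilibrium. -/
theorem tendsto_equilibrium (H : PerturbedEuler h θ ζ γ C) {R : ℝ} (hR : ∀ t, ‖θ t‖ ≤ R)
    {θs : Vec p} (hstable : IsAsymptoticallyStable h θs) {S : Set (Vec p)} (hS : IsCompact S)
    (hSb : S ⊆ basin h θs) (hrec : ∃ᶠ t in atTop, θ t ∈ S) : Tendsto θ atTop (𝓝 θs) := by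
  rw [Metric.tendsto_nhds]
  intro ε hε
  by_contra hcon
  rw [not_eventually] at hcon
  obtain ⟨δ, hδ, hst⟩ := hstable.stable ε hε
  obtain ⟨r, hr, hball⟩ := hstable.attractive
  obtain ⟨δ', hδ', hδδ, hδr, hδε⟩ : ∃ δ' > 0, δ' < δ ∧ δ' < r ∧ δ' < ε :=
    ⟨min (min δ r) ε / 2, by positivity, by
      have := min_le_left (min δ r) ε; have := min_le_left δ r; have := lt_min (lt_min hδ hr) hε
      linarith, by
      have := min_le_left (min δ r) ε; have := min_le_right δ r; have := lt_min (lt_min hδ hr) hε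
      linarith, by
      have := min_le_right (min δ r) ε; have := lt_min (lt_min hδ hr) hε
      linarith⟩
  have hvisit := H.frequently_dist_lt hR hS hSb hrec hδ'
  -- `t` is the last visit to the small ball before an excursion that reaches distance `ε` at step
  -- `u`.
  have hexit : ∃ᶠ t in atTop, dist (θ t) θs < δ' ∧ ∃ u, t < u ∧ ε ≤ dist (θ u) θs ∧
      ∀ i, t < i → i ≤ u → δ' ≤ dist (θ i) θs := by
    rw [frequently_atTop]
    intro n₀
    obtain ⟨a, ha, hda⟩ := frequently_atTop.1 hvisit n₀
    obtain ⟨u, hu, hdu⟩ := frequently_atTop.1 hcon a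
    push Not at hdu
    let P : ℕ → Prop := fun i => dist (θ i) θs < δ'
    classical
    have h1 : P (Nat.findGreatest P u) := Nat.findGreatest_spec hu hda
    have h2 : Nat.findGreatest P u ≤ u := Nat.findGreatest_le u
    refine ⟨Nat.findGreatest P u, ha.trans (Nat.le_findGreatest hu hda), h1, u, ?_, hdu, ?_⟩
    · refine lt_of_le_of_ne h2 fun h3 => ?_
      rw [h3] at h1
      exact absurd h1 (not_lt.2 (hδε.le.trans hdu))
    · intro i hi hiu
      exact not_lt.1 (Nat.findGreatest_is_greatest hi hiu)
  obtain ⟨𝒰, h𝒰, h𝒰P⟩ := exists_ultrafilter hexit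
  obtain ⟨x, hx⟩ := exists_isLimitPath hR γ 𝒰
  have hsol := H.isSolution_limitPath h𝒰 hx
  have h0 : ∀ t, timeIndex γ t 0 = t := fun t =>
    le_antisymm (timeIndex_le le_rfl (by simp)) (H.timeIndex_spec t 0).1
  have hx0 : dist (x 0) θs ≤ δ' := by
    refine le_of_tendsto ((hx 0).dist tendsto_const_nhds) ?_
    filter_upwards [h𝒰P] with t ht
    rw [h0]
    exact ht.1.le
  have hex : ∀ t, ∃ u, (dist (θ t) θs < δ' ∧ ∃ u, t < u ∧ ε ≤ dist (θ u) θs ∧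
      ∀ i, t < i → i ≤ u → δ' ≤ dist (θ i) θs) → t < u ∧ ε ≤ dist (θ u) θs ∧
      ∀ i, t < i → i ≤ u → δ' ≤ dist (θ i) θs := by
    intro t
    by_cases h1 : ∃ u, t < u ∧ ε ≤ dist (θ u) θs ∧ ∀ i, t < i → i ≤ u → δ' ≤ dist (θ i) θs
    · obtain ⟨u, hu⟩ := h1
      exact ⟨u, fun _ => hu⟩
    -- An arbitrary value where no excursion starts.
    · exact ⟨0, fun h2 => absurd h2.2 h1⟩
  choose u hu using hex
  have hu' : ∀ᶠ t in (𝒰 : Filter ℕ), t < u t ∧ ε ≤ dist (θ (u t)) θs ∧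
      ∀ i, t < i → i ≤ u t → δ' ≤ dist (θ i) θs := h𝒰P.mono hu
  -- If the excursion durations are bounded along `𝒰`, they converge to some `τ`, and the limit path
  -- goes from within `δ` of `θs` to distance `ε` at time `τ`, against stability. If not, it avoids
  -- the small ball at all positive times, against attraction.
  by_cases hbd : ∃ T : ℝ, ∀ᶠ t in (𝒰 : Filter ℕ), clock γ (u t) - clock γ t ≤ T
  · obtain ⟨T, hT⟩ := hbd
    obtain ⟨τ, hτ, hlim⟩ := (isCompact_Icc (a := (0 : ℝ)) (b := T)).ultrafilter_le_nhds
      (𝒰.map fun t => clock γ (u t) - clock γ t) (by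
        rw [le_principal_iff]
        refine mem_map.2 ?_
        filter_upwards [hT, hu'] with t h1 h2
        exact ⟨sub_nonneg.2 (clock_mono H.pos h2.1.le), h1⟩)
    have hlim : Tendsto (fun t => clock γ (u t) - clock γ t) 𝒰 (𝓝 τ) := hlim
    have hel := (H.tendsto_elapsed τ).mono_left h𝒰
    rw [max_eq_left hτ.1] at hel
    have hdiff : Tendsto (fun t => (C + 1) * |clock γ (u t) - clock γ t -
        (clock γ (timeIndex γ t τ) - clock γ t)|) 𝒰 (𝓝 0) := by
      have := ((hlim.sub hel).abs).const_mul (C + 1)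
      simpa using this
    -- The steps `u t` and `timeIndex γ t τ` have asymptotically equal clocks, so the iterates there
    -- merge.
    have hclose : Tendsto (fun t => dist (θ (u t)) (θ (timeIndex γ t τ))) 𝒰 (𝓝 0) := by
      rw [Metric.tendsto_nhds]
      intro κ hκ
      obtain ⟨n₀, hn₀⟩ := H.norm_sub_le (half_pos hκ)
      filter_upwards [h𝒰 (eventually_ge_atTop n₀), hdiff.eventually_lt_const (half_pos hκ),
        hu'] with t ht h1 h2
      rw [Real.dist_0_eq_abs, abs_of_nonneg dist_nonneg]
      rw [sub_sub_sub_cancel_right] at h1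
      have hC := H.C_nonneg
      have h3 := (H.timeIndex_spec t τ).1
      rcases le_total (u t) (timeIndex γ t τ) with h4 | h4
      · have h5 := hn₀ (u t) (ht.trans h2.1.le) _ h4
        rw [abs_sub_comm, abs_of_nonneg (sub_nonneg.2 (clock_mono H.pos h4))] at h1
        rw [dist_comm, dist_eq_norm]
        linarith
      · have h5 := hn₀ (timeIndex γ t τ) (ht.trans h3) _ h4
        rw [abs_of_nonneg (sub_nonneg.2 (clock_mono H.pos h4))] at h1
        rw [dist_eq_norm]
        linarith
    have hge : ε ≤ dist (x τ) θs := by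
      have h1 := hclose.add ((hx τ).dist (tendsto_const_nhds (x := θs)))
      rw [zero_add] at h1
      refine ge_of_tendsto h1 ?_
      filter_upwards [hu'] with t ht
      exact ht.2.1.trans (dist_triangle _ _ _)
    exact absurd (hst τ x (hsol τ hτ.1) (hx0.trans_lt hδδ) τ ⟨hτ.1, le_rfl⟩) (not_lt.2 hge)
  · push Not at hbd
    have hfar : ∀ s > 0, δ' ≤ dist (x s) θs := by
      intro s hs
      refine ge_of_tendsto ((hx s).dist tendsto_const_nhds) ?_
      filter_upwards [hbd s, hu'] with t h2 h3
      refine h3.2.2 _ ?_ (timeIndex_le h3.1.le h2.le)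
      obtain ⟨h4, h5⟩ := H.timeIndex_spec t s
      refine lt_of_le_of_ne h4 fun h6 => ?_
      rw [← h6, sub_self] at h5
      exact absurd hs (not_lt.2 h5)
    have hlim := (hball (Metric.mem_ball.2 (hx0.trans_lt hδr))).2 x hsol rfl
    obtain ⟨s, hs1, hs2⟩ := ((Metric.tendsto_nhds.1 hlim δ' hδ').and
      (eventually_gt_atTop 0)).exists
    exact absurd hs1 (not_lt.2 (hfar s hs2))

end PerturbedEuler

namespace Data

variable {p m : ℕ} {Ω : Type*}

/-! ### The counters of the algorithm -/

/-- The point before step `t` is feasible. -/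
def FeasibleAt (D : Data p m Ω) (ω : Ω) (t : ℕ) : Prop := D.iterate t ω ∈ feasible D.q

/-- The number of SPSA steps before step `t`. -/
def spsaCount (D : Data p m Ω) (ω : Ω) (t : ℕ) : ℕ := (D.state ω t).count

/-- The inner loop counter before step `t`. -/
def innerCount (D : Data p m Ω) (ω : Ω) (t : ℕ) : ℕ := (D.state ω t).inner

open Classical in
/-- The gain used in step `t`. -/
def stepGain (D : Data p m Ω) (ω : Ω) (t : ℕ) : ℝ :=
  if D.FeasibleAt ω t then D.gainA (D.kappa t ω)
  else D.innerGain (D.kappa t ω) (D.innerCount ω t)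

variable (D : Data p m Ω) (ω : Ω)

lemma step_of_mem {s : State p} (h : s.pt ∈ feasible D.q) :
    D.step ω s = ⟨s.pt - D.gainA (D.counter s) • D.gradEstimate (D.counter s) s.pt ω,
      s.count + 1, 0⟩ := by
  rw [step, if_pos h]

lemma step_of_notMem {s : State p} (h : s.pt ∉ feasible D.q) :
    D.step ω s = ⟨s.pt - D.innerGain (D.counter s) s.inner • constraintGrad D.q s.pt,
      s.count, s.inner + 1⟩ := by
  rw [step, if_neg h]

variable {D ω}

lemma kappa_of_feasible {t : ℕ} (h : D.FeasibleAt ω t) : D.kappa t ω = D.spsaCount ω t :=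
  if_pos h

lemma kappa_of_not_feasible {t : ℕ} (h : ¬ D.FeasibleAt ω t) :
    D.kappa t ω = D.spsaCount ω t - 1 :=
  if_neg h

lemma spsaCount_zero : D.spsaCount ω 0 = 0 := rfl

lemma spsaCount_succ_of_feasible {t : ℕ} (h : D.FeasibleAt ω t) :
    D.spsaCount ω (t + 1) = D.spsaCount ω t + 1 := by
  change (D.step ω (D.state ω t)).count = _
  rw [D.step_of_mem ω h]; rfl

lemma spsaCount_succ_of_not_feasible {t : ℕ} (h : ¬ D.FeasibleAt ω t) :
    D.spsaCount ω (t + 1) = D.spsaCount ω t := by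
  change (D.step ω (D.state ω t)).count = _
  rw [D.step_of_notMem ω h]; rfl

lemma innerCount_succ_of_feasible {t : ℕ} (h : D.FeasibleAt ω t) :
    D.innerCount ω (t + 1) = 0 := by
  change (D.step ω (D.state ω t)).inner = _
  rw [D.step_of_mem ω h]

lemma innerCount_succ_of_not_feasible {t : ℕ} (h : ¬ D.FeasibleAt ω t) :
    D.innerCount ω (t + 1) = D.innerCount ω t + 1 := by
  change (D.step ω (D.state ω t)).inner = _
  rw [D.step_of_notMem ω h]; rfl

lemma iterate_succ_of_feasible {t : ℕ} (h : D.FeasibleAt ω t) :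
    D.iterate (t + 1) ω = D.iterate t ω -
      D.gainA (D.spsaCount ω t) • D.gradEstimate (D.spsaCount ω t) (D.iterate t ω) ω := by
  rw [← kappa_of_feasible h]
  change (D.step ω (D.state ω t)).pt = _
  rw [D.step_of_mem ω h]; rfl

lemma iterate_succ_of_not_feasible {t : ℕ} (h : ¬ D.FeasibleAt ω t) :
    D.iterate (t + 1) ω = D.iterate t ω -
      D.innerGain (D.kappa t ω) (D.innerCount ω t) • constraintGrad D.q (D.iterate t ω) := by
  change (D.step ω (D.state ω t)).pt = _
  rw [D.step_of_notMem ω h]; rfl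

lemma spsaCount_mono : Monotone (D.spsaCount ω) := by
  refine monotone_nat_of_le_succ fun t => ?_
  by_cases h : D.FeasibleAt ω t
  · rw [spsaCount_succ_of_feasible h]; omega
  · rw [spsaCount_succ_of_not_feasible h]

lemma kappa_le (t : ℕ) : D.kappa t ω ≤ D.spsaCount ω t := by
  by_cases h : D.FeasibleAt ω t
  · rw [kappa_of_feasible h]
  · rw [kappa_of_not_feasible h]; omega

lemma spsaCount_le_kappa_succ (t : ℕ) : D.spsaCount ω t ≤ D.kappa t ω + 1 := by
  by_cases h : D.FeasibleAt ω t
  · rw [kappa_of_feasible h]; omega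
  · rw [kappa_of_not_feasible h]; omega

/-- The drop by one on entering an inner loop is offset by the increase of the count in the
preceding SPSA step; truncated subtraction covers the start of the run. -/
lemma kappa_mono : Monotone fun t => D.kappa t ω := by
  refine monotone_nat_of_le_succ fun t => ?_
  by_cases h : D.FeasibleAt ω t
  · have := spsaCount_le_kappa_succ (D := D) (ω := ω) (t + 1)
    rw [spsaCount_succ_of_feasible h] at this
    rw [kappa_of_feasible h]
    omega
  · have h1 := spsaCount_succ_of_not_feasible h
    rw [kappa_of_not_feasible h]
    by_cases h' : D.FeasibleAt ω (t + 1)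
    · rw [kappa_of_feasible h', h1]; omega
    · rw [kappa_of_not_feasible h', h1]

lemma spsaCount_le (t : ℕ) : D.spsaCount ω t ≤ t := by
  induction t with
  | zero => rfl
  | succ t ih =>
    by_cases h : D.FeasibleAt ω t
    · rw [spsaCount_succ_of_feasible h]; omega
    · rw [spsaCount_succ_of_not_feasible h]; omega

-- The count grows by one exactly at feasible steps, so those in a window run through the SPSA
-- indices between the counts at its ends, each once.
open Classical in
lemma sum_Ico_feasible {M : Type*} [AddCommMonoid M] (f : ℕ → M) {n t : ℕ} (hnt : n ≤ t) :
    ∑ s ∈ Finset.Ico n t, (if D.FeasibleAt ω s then f (D.spsaCount ω s) else 0) =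
      ∑ k ∈ Finset.Ico (D.spsaCount ω n) (D.spsaCount ω t), f k := by
  induction t, hnt using Nat.le_induction with
  | base => simp
  | succ t ht ih =>
    rw [Finset.sum_Ico_succ_top ht, ih]
    by_cases h : D.FeasibleAt ω t
    · rw [spsaCount_succ_of_feasible h, Finset.sum_Ico_succ_top (spsaCount_mono ht), if_pos h]
    · rw [spsaCount_succ_of_not_feasible h, if_neg h, add_zero]

open Classical in
lemma sum_range_feasible {M : Type*} [AddCommMonoid M] (f : ℕ → M) (t : ℕ) :
    ∑ s ∈ Finset.range t, (if D.FeasibleAt ω s then f (D.spsaCount ω s) else 0) =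
      ∑ k ∈ Finset.range (D.spsaCount ω t), f k := by
  rw [Finset.range_eq_Ico, sum_Ico_feasible f (Nat.zero_le t), Finset.range_eq_Ico]
  rfl

lemma measurementProportion_eq (t : ℕ) :
    D.measurementProportion t ω = (D.spsaCount ω t : ℝ) / t := by
  classical
  rw [measurementProportion]
  congr 2
  have h := sum_range_feasible (D := D) (ω := ω) (fun _ => 1) t
  rw [Finset.card_filter]
  simp only [Finset.sum_const, Finset.card_range, smul_eq_mul, mul_one] at h
  exact h

/-- Identifies the current inner loop with a window of steps, so that differences of partial sums
can measure it. -/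
lemma innerCount_spec (t : ℕ) :
    D.innerCount ω t ≤ t ∧ ∀ s, t - D.innerCount ω t ≤ s → s < t → ¬ D.FeasibleAt ω s := by
  induction t with
  | zero => exact ⟨le_rfl, fun s _ h => absurd h (Nat.not_lt_zero s)⟩
  | succ t ih =>
    by_cases h : D.FeasibleAt ω t
    · rw [innerCount_succ_of_feasible h]
      exact ⟨Nat.zero_le _, fun s h1 h2 => by omega⟩
    · rw [innerCount_succ_of_not_feasible h]
      refine ⟨by omega, fun s h1 h2 => ?_⟩
      rcases (Nat.lt_succ_iff.1 h2).eq_or_lt with h3 | h3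
      · rwa [h3]
      · exact ih.2 s (by omega) h3

lemma tendsto_kappa (h : ∀ t, ∃ t', D.kappa t ω < D.kappa (t + t') ω) :
    Tendsto (fun t => D.kappa t ω) atTop atTop := by
  refine tendsto_atTop_atTop_of_monotone kappa_mono fun b => ?_
  induction b with
  | zero => exact ⟨0, Nat.zero_le _⟩
  | succ b ih =>
    obtain ⟨t, ht⟩ := ih
    obtain ⟨t', ht'⟩ := h t
    exact ⟨t + t', by omega⟩

lemma tendsto_spsaCount (h : Tendsto (fun t => D.kappa t ω) atTop atTop) :
    Tendsto (D.spsaCount ω) atTop atTop :=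
  tendsto_atTop_mono kappa_le h

/-- The count is unbounded and never jumps by more than one; the step after which it first exceeds
`k` is the required one. -/
lemma exists_spsa_step (h : Tendsto (D.spsaCount ω) atTop atTop) (k : ℕ) :
    ∃ t, D.FeasibleAt ω t ∧ D.spsaCount ω t = k := by
  classical
  have hex : ∃ t, k < D.spsaCount ω t := (h.eventually_gt_atTop k).exists
  obtain ⟨t, ht⟩ : ∃ t, Nat.find hex = t + 1 := by
    refine Nat.exists_eq_succ_of_ne_zero fun h0 => ?_
    have := Nat.find_spec hex
    rw [h0, spsaCount_zero] at this
    omega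
  have h1 : k < D.spsaCount ω (t + 1) := ht ▸ Nat.find_spec hex
  have h2 : ¬ k < D.spsaCount ω t := Nat.find_min hex (by omega)
  refine ⟨t, ?_⟩
  by_cases hf : D.FeasibleAt ω t
  · rw [spsaCount_succ_of_feasible hf] at h1
    exact ⟨hf, by omega⟩
  · rw [spsaCount_succ_of_not_feasible hf] at h1
    exact absurd h1 h2

/-! ### The gains -/

lemma gainA_pos [MeasurableSpace Ω] (hD : D.Standing) (k : ℕ) : 0 < D.gainA k := by
  have h1 := hD.A_nonneg
  have h2 := hD.a_pos
  rw [gainA]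
  positivity

lemma gainA_antitone [MeasurableSpace Ω] (hD : D.Standing) (hα : 0 ≤ D.α) :
    Antitone D.gainA := by
  intro k l hkl
  have h1 := hD.A_nonneg
  have h2 := hD.a_pos
  rw [gainA, gainA]
  have : (k : ℝ) ≤ l := by exact_mod_cast hkl
  gcongr

/-- The sum of the gains is at most of the order of `k a_k`. -/
lemma clock_gainA_le [MeasurableSpace Ω] (hD : D.Standing) (hα : D.α ∈ Set.Ioo (1 / 2 : ℝ) 1)
    (k : ℕ) : clock D.gainA k ≤ ((k : ℝ) + 1 + D.A) / (1 - D.α) * D.gainA k := by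
  have hA := hD.A_nonneg
  have ha := hD.a_pos
  have h1 : 0 < 1 - D.α := by linarith [hα.2]
  have h2 : 1 - D.α ≤ 1 := by linarith [hα.1]
  have hx : ∀ k : ℕ, (0 : ℝ) < (k : ℝ) + 1 + D.A := fun k => by positivity
  have hgain : ∀ k : ℕ, D.gainA k =
      D.a * (((k : ℝ) + 1 + D.A) ^ (1 - D.α) / ((k : ℝ) + 1 + D.A)) := by
    intro k
    rw [gainA, Real.rpow_sub (hx k), Real.rpow_one]
    have := (Real.rpow_pos_of_pos (hx k) D.α).ne'
    have := (hx k).ne'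
    field_simp
  -- Comparison of the sum with the integral of the power; the induction step is Bernoulli's
  -- inequality with exponent `1 - α`.
  have step : ∀ k : ℕ, clock D.gainA k ≤ D.a / (1 - D.α) * ((k : ℝ) + D.A) ^ (1 - D.α) := by
    intro k
    induction k with
    | zero => simp only [clock, Finset.range_zero, Finset.sum_empty]; positivity
    | succ k ih =>
      have e0 : clock D.gainA (k + 1) = clock D.gainA k + D.gainA k := Finset.sum_range_succ _ _
      set x := (k : ℝ) + 1 + D.A with hxdef
      have hx0 : 0 < x := hx k
      have hx1 : 1 ≤ x := by
        have : (0 : ℝ) ≤ k := Nat.cast_nonneg k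
        linarith
      have e1 : (k : ℝ) + D.A = x * (1 + -(1 / x)) := by
        field_simp
        rw [hxdef]; ring
      have hb : -1 ≤ -(1 / x) := by
        rw [neg_le_neg_iff, div_le_one hx0]; exact hx1
      have e2 : ((k : ℝ) + D.A) ^ (1 - D.α) ≤
          x ^ (1 - D.α) * (1 + (1 - D.α) * -(1 / x)) := by
        rw [e1, Real.mul_rpow hx0.le (by linarith)]
        exact mul_le_mul_of_nonneg_left
          (rpow_one_add_le_one_add_mul_self hb h1.le h2) (by positivity)
      have e3 : ((k + 1 : ℕ) : ℝ) + D.A = x := by push_cast; ring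
      rw [e0, e3, hgain k, ← hxdef]
      have e4 : D.a / (1 - D.α) * ((k : ℝ) + D.A) ^ (1 - D.α) ≤
          D.a / (1 - D.α) * (x ^ (1 - D.α) * (1 + (1 - D.α) * -(1 / x))) :=
        mul_le_mul_of_nonneg_left e2 (by positivity)
      have e5 : D.a / (1 - D.α) * (x ^ (1 - D.α) * (1 + (1 - D.α) * -(1 / x))) +
          D.a * (x ^ (1 - D.α) / x) = D.a / (1 - D.α) * x ^ (1 - D.α) := by
        field_simp
        ring
      linarith
  refine (step k).trans ?_
  have e6 : ((k : ℝ) + D.A) ^ (1 - D.α) ≤ ((k : ℝ) + 1 + D.A) ^ (1 - D.α) :=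
    Real.rpow_le_rpow (by positivity) (by linarith) h1.le
  refine (mul_le_mul_of_nonneg_left e6 (by positivity)).trans (le_of_eq ?_)
  rw [hgain k]
  have := (hx k).ne'
  field_simp

/-- The factor by which the gain is reduced in the inner loop. -/
lemma innerGain_eq (k l : ℕ) : D.innerGain k l =
    D.gainA k * (1 - (l : ℝ) / ((k : ℝ) + 2 * l + 1)) ^ D.β := by
  have h1 : (1 - (l : ℝ) / ((k : ℝ) + 2 * l + 1)) =
      ((k : ℝ) + l + 1) / ((k : ℝ) + 2 * l + 1) := by
    have : ((k : ℝ) + 2 * l + 1) ≠ 0 := by positivity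
    field_simp
    ring
  rw [h1, Real.div_rpow (by positivity) (by positivity), innerGain, mul_div_assoc]

/-- `l / (k + 2l + 1) ≤ 1/2` however long the inner loop is. This crude bound is what is available
before inner loops are known to be short. -/
lemma innerGain_bounds [MeasurableSpace Ω] (hD : D.Standing) (k l : ℕ) :
    D.gainA k * (1 / 2 : ℝ) ^ D.β ≤ D.innerGain k l ∧ D.innerGain k l ≤ D.gainA k := by
  have hp := gainA_pos hD k
  have hβ := hD.β_nonneg
  have h0 : (0 : ℝ) < (k : ℝ) + 2 * l + 1 := by positivity
  have h1 : 1 / 2 ≤ 1 - (l : ℝ) / ((k : ℝ) + 2 * l + 1) := by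
    have : (l : ℝ) / ((k : ℝ) + 2 * l + 1) ≤ 1 / 2 := by
      rw [div_le_div_iff₀ h0 (by norm_num)]
      have : (0 : ℝ) ≤ k := Nat.cast_nonneg k
      linarith
    linarith
  have h2 : 1 - (l : ℝ) / ((k : ℝ) + 2 * l + 1) ≤ 1 := by
    have : 0 ≤ (l : ℝ) / ((k : ℝ) + 2 * l + 1) := by positivity
    linarith
  rw [innerGain_eq]
  constructor
  · exact mul_le_mul_of_nonneg_left (Real.rpow_le_rpow (by norm_num) h1 hβ) hp.le
  · exact mul_le_of_le_one_right hp.le (Real.rpow_le_one (by linarith) h2 hβ)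

lemma stepGain_bounds [MeasurableSpace Ω] (hD : D.Standing) (t : ℕ) :
    D.gainA (D.kappa t ω) * (1 / 2 : ℝ) ^ D.β ≤ D.stepGain ω t ∧
      D.stepGain ω t ≤ D.gainA (D.kappa t ω) := by
  rw [stepGain]
  split_ifs
  · exact ⟨mul_le_of_le_one_right (gainA_pos hD _).le
      (Real.rpow_le_one (by norm_num) (by norm_num) hD.β_nonneg), le_rfl⟩
  · exact innerGain_bounds hD _ _

lemma stepGain_pos [MeasurableSpace Ω] (hD : D.Standing) (t : ℕ) : 0 < D.stepGain ω t :=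
  (mul_pos (gainA_pos hD _) (by positivity)).trans_le (stepGain_bounds hD t).1

-- Infeasible steps only add time. Thus divergence of the clock and negligibility of the noise pass
-- from SPSA indices to steps.
open Classical in
lemma sum_Ico_gainA_le [MeasurableSpace Ω] (hD : D.Standing) {n t : ℕ} (hnt : n ≤ t) :
    ∑ k ∈ Finset.Ico (D.spsaCount ω n) (D.spsaCount ω t), D.gainA k ≤
      ∑ s ∈ Finset.Ico n t, D.stepGain ω s := by
  rw [← sum_Ico_feasible _ hnt]
  refine Finset.sum_le_sum fun s _ => ?_
  by_cases h : D.FeasibleAt ω s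
  · rw [if_pos h, stepGain, if_pos h, kappa_of_feasible h]
  · rw [if_neg h]; exact (stepGain_pos hD s).le

lemma clock_gainA_le_clock_stepGain [MeasurableSpace Ω] (hD : D.Standing) (t : ℕ) :
    clock D.gainA (D.spsaCount ω t) ≤ clock (D.stepGain ω) t := by
  have := sum_Ico_gainA_le (ω := ω) hD (Nat.zero_le t)
  rwa [spsaCount_zero, ← Finset.range_eq_Ico, ← Finset.range_eq_Ico] at this

end Data

open Asymptotics

/-! ### Weighted sums -/

/-- Past a fixed `n₀` the sum is controlled by negligibility; the diverging clock absorbs the head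
and the constant term. -/
lemma NegligibleSum.isLittleO {E : Type*} [NormedAddCommGroup E] {a : ℕ → ℝ} {ζ : ℕ → E}
    (h : NegligibleSum a ζ) (ha : ∀ t, 0 < a t) (hdiv : Tendsto (clock a) atTop atTop) :
    (fun t => ∑ k ∈ Finset.range t, ζ k) =o[atTop] clock a := by
  rw [isLittleO_iff]
  intro ε hε
  obtain ⟨n₀, hn₀⟩ := h (ε / 2) (by positivity)
  have hc := hdiv.eventually_ge_atTop ((‖∑ k ∈ Finset.range n₀, ζ k‖ + ε / 2) / (ε / 2))
  filter_upwards [eventually_ge_atTop n₀, hc] with t ht h1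
  have h2 := hn₀ n₀ le_rfl t ht
  rw [sum_Ico_eq_clock_sub a ht] at h2
  have h3 : 0 ≤ clock a n₀ := Finset.sum_nonneg fun k _ => (ha k).le
  have h4 : 0 ≤ clock a t := Finset.sum_nonneg fun k _ => (ha k).le
  rw [← Finset.sum_range_add_sum_Ico ζ ht, Real.norm_of_nonneg h4]
  rw [div_le_iff₀ (by positivity)] at h1
  refine (norm_add_le _ _).trans ?_
  nlinarith

/-- A function that is small compared to a monotone unbounded one is so uniformly on initial
segments. -/
lemma eventually_forall_le_of_isLittleO {E u : ℕ → ℝ} (h : E =o[atTop] u) (hu : Monotone u)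
    (hdiv : Tendsto u atTop atTop) {ε : ℝ} (hε : 0 < ε) :
    ∀ᶠ t in atTop, ∀ s ≤ t, |E s| ≤ ε * u t := by
  obtain ⟨n₀, hn₀⟩ := eventually_atTop.1 ((isLittleO_iff.1 h hε).and (hdiv.eventually_ge_atTop 0))
  have hc := hdiv.eventually_ge_atTop ((∑ s ∈ Finset.range n₀, |E s|) / ε)
  filter_upwards [hc] with t ht s hs
  rcases le_total n₀ s with h1 | h1
  · obtain ⟨h2, h3⟩ := hn₀ s h1
    rw [Real.norm_eq_abs, Real.norm_of_nonneg h3] at h2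
    exact h2.trans (mul_le_mul_of_nonneg_left (hu hs) hε.le)
  · rcases h1.eq_or_lt with h2 | h2
    · obtain ⟨h4, h3⟩ := hn₀ s h2.ge
      rw [Real.norm_eq_abs, Real.norm_of_nonneg h3] at h4
      exact h4.trans (mul_le_mul_of_nonneg_left (hu hs) hε.le)
    · rw [div_le_iff₀ hε] at ht
      have := Finset.single_le_sum (f := fun s => |E s|) (fun i _ => abs_nonneg _)
        (Finset.mem_range.2 h2)
      linarith

/-- Removal of decreasing weights from a sum by partial summation. -/
lemma isLittleO_sum_of_weighted {b y u : ℕ → ℝ} (hb : ∀ t, 0 < b t) (hanti : Antitone b)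
    (hR : (fun t => ∑ s ∈ Finset.range t, b s * y s) =o[atTop] u) (hu : Monotone u)
    (hdiv : Tendsto u atTop atTop) {c : ℝ} (hub : ∀ᶠ t : ℕ in atTop, u t ≤ c * t * b t) :
    (fun t => ∑ s ∈ Finset.range t, y s) =o[atTop] (fun t : ℕ => (t : ℝ)) := by
  set R : ℕ → ℝ := fun t => ∑ s ∈ Finset.range t, b s * y s with hRdef
  -- Partial summation: the difference is minus the sum of `R (s + 1) * (1 / b (s + 1) - 1 / b s)`,
  -- and since `1 / b` increases the bounds telescope.
  have key : ∀ (M : ℝ) (T : ℕ), (∀ s ≤ T, |R s| ≤ M) → ∀ t ≤ T,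
      |∑ s ∈ Finset.range t, y s - R t / b t| ≤ M * (1 / b t - 1 / b 0) := by
    intro M T hM t
    induction t with
    | zero => intro _; simp [hRdef]
    | succ t ih =>
      intro ht
      have h1 := ih (by omega)
      have h2 := hM (t + 1) ht
      have h3 : R (t + 1) = R t + b t * y t := Finset.sum_range_succ _ _
      have h4 : ∑ s ∈ Finset.range (t + 1), y s - R (t + 1) / b (t + 1) =
          (∑ s ∈ Finset.range t, y s - R t / b t) -
            R (t + 1) * (1 / b (t + 1) - 1 / b t) := by
        rw [Finset.sum_range_succ]
        have : y t = R (t + 1) / b t - R t / b t := by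
          rw [h3, ← sub_div, add_sub_cancel_left, mul_div_cancel_left₀ _ (hb t).ne']
        rw [this]
        ring
      have h5 : 0 ≤ 1 / b (t + 1) - 1 / b t :=
        sub_nonneg.2 (one_div_le_one_div_of_le (hb _) (hanti (Nat.le_succ t)))
      rw [h4]
      refine (abs_sub _ _).trans ?_
      rw [abs_mul, abs_of_nonneg h5]
      have := mul_le_mul_of_nonneg_right h2 h5
      linarith
  rw [isLittleO_iff]
  intro ε hε
  have hc : 0 < |c| + 1 := by positivity
  filter_upwards [eventually_forall_le_of_isLittleO hR hu hdiv
    (show 0 < ε / (2 * (|c| + 1)) by positivity), hub, hdiv.eventually_ge_atTop 0] with t h1 h2 h3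
  have h4 := key _ t h1 t le_rfl
  have h5 := h1 t le_rfl
  have hbt := hb t
  set M := ε / (2 * (|c| + 1)) * u t with hM
  have hM0 : 0 ≤ M := by positivity
  -- The boundary term and the summation term each cost at most `M / b t`.
  have h6 : |∑ s ∈ Finset.range t, y s| ≤ 2 * (M / b t) := by
    have e1 : |R t / b t| ≤ M / b t := by
      rw [abs_div, abs_of_pos hbt]
      exact div_le_div_of_nonneg_right h5 hbt.le
    have e2 : M * (1 / b t - 1 / b 0) ≤ M / b t := by
      have : 0 ≤ M * (1 / b 0) := mul_nonneg hM0 (one_div_nonneg.2 (hb 0).le)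
      rw [mul_sub, mul_one_div]
      linarith
    have e3 := abs_add_le (∑ s ∈ Finset.range t, y s - R t / b t) (R t / b t)
    rw [sub_add_cancel] at e3
    linarith
  rw [Real.norm_eq_abs, Real.norm_of_nonneg (Nat.cast_nonneg t)]
  refine h6.trans ?_
  have h7 : u t / b t ≤ (|c| + 1) * t := by
    rw [div_le_iff₀ hbt]
    refine h2.trans ?_
    have : c ≤ |c| + 1 := by linarith [le_abs_self c]
    gcongr
  calc 2 * (M / b t) = ε / (|c| + 1) * (u t / b t) := by rw [hM]; field_simp
    _ ≤ ε / (|c| + 1) * ((|c| + 1) * t) := by gcongr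
    _ = ε * t := by field_simp

/-! ### The field near a KKT point -/

lemma continuous_gradient {p : ℕ} {f : Vec p → ℝ} (hf : ContDiff ℝ 1 f) :
    Continuous (gradient f) := by
  have : Continuous (fderiv ℝ f) := hf.continuous_fderiv one_ne_zero
  exact (InnerProductSpace.toDual ℝ (Vec p)).symm.continuous.comp this

/-- Under LICQ there is a linear functional that is one on the gradients of the active
constraints. -/
lemma LICQ.exists_functional {p m : ℕ} {q : Fin m → Vec p → ℝ} {θ : Vec p} (h : LICQ q θ) :
    ∃ φ : Vec p →L[ℝ] ℝ, ∀ i, q i θ = 0 → φ (gradient (q i) θ) = 1 := by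
  have hli : LinearIndependent ℝ (fun i : {i : Fin m // q i θ = 0} => gradient (q i.1) θ) := h
  obtain ⟨g, hg⟩ := ((Module.Basis.span hli).constr ℝ (fun _ => (1 : ℝ))).exists_extend
  refine ⟨LinearMap.toContinuousLinearMap g, fun i hi => ?_⟩
  have h1 := LinearMap.congr_fun hg (Module.Basis.span hli ⟨i, hi⟩)
  rw [Module.Basis.constr_basis] at h1
  rw [LinearMap.comp_apply, Submodule.subtype_apply, Module.Basis.span_apply] at h1
  exact h1

/-- The first violated index is unique, so the sum in `constraintGrad` has a single nonzero summand
at most. -/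
lemma exists_isFirstViolated {p m : ℕ} {q : Fin m → Vec p → ℝ} {θ : Vec p}
    (h : θ ∉ feasible q) : ∃ i, IsFirstViolated q θ i ∧ constraintGrad q θ = gradient (q i) θ := by
  classical
  have hne : (Finset.univ.filter fun i => 0 < q i θ).Nonempty := by
    simp only [feasible, Set.mem_ofPred_eq, not_forall, not_le] at h
    obtain ⟨i, hi⟩ := h
    exact ⟨i, by simpa using hi⟩
  set i := (Finset.univ.filter fun i => 0 < q i θ).min' hne with hidef
  have hi : IsFirstViolated q θ i := by
    refine ⟨(Finset.mem_filter.1 (Finset.min'_mem _ hne)).2, fun j hj => ?_⟩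
    by_contra! hpos
    exact absurd (Finset.min'_le _ j (by simpa using hpos)) (not_le.2 hj)
  refine ⟨i, hi, ?_⟩
  rw [constraintGrad, Finset.sum_eq_single i, if_pos hi]
  · intro j _ hji
    refine if_neg fun hj => ?_
    rcases lt_or_gt_of_ne hji with h1 | h1
    · exact absurd hj.1 (not_lt.2 (hi.2 j h1))
    · exact absurd hi.1 (not_lt.2 (hj.2 i h1))
  · simp

lemma switchField_of_mem {p m : ℕ} {L : Vec p → ℝ} {q : Fin m → Vec p → ℝ} {θ : Vec p}
    (h : θ ∈ feasible q) : switchField L q θ = gradient L θ :=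
  if_pos h

lemma switchField_of_notMem {p m : ℕ} {L : Vec p → ℝ} {q : Fin m → Vec p → ℝ} {θ : Vec p}
    (h : θ ∉ feasible q) : switchField L q θ = constraintGrad q θ :=
  if_neg h

open Classical in
/-- Along a sequence converging to a KKT point, a suitable linear functional of the field only
depends on the feasibility of the point, asymptotically. -/
lemma exists_functional_tendsto {p m : ℕ} {L : Vec p → ℝ} {q : Fin m → Vec p → ℝ}
    (hL : ContDiff ℝ 1 L) (hq : ∀ i, ContDiff ℝ 1 (q i)) {θs : Vec p} {lam : Fin m → ℝ}
    (hKKT : IsKKTWith L q θs lam) (hLICQ : LICQ q θs) {θ : ℕ → Vec p}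
    (hθ : Tendsto θ atTop (𝓝 θs)) :
    ∃ φ : Vec p →L[ℝ] ℝ, Tendsto (fun t => φ (switchField L q (θ t)) -
      (1 - (1 + ∑ i, lam i) * if θ t ∈ feasible q then 1 else 0)) atTop (𝓝 0) := by
  obtain ⟨φ, hφ⟩ := hLICQ.exists_functional
  refine ⟨φ, ?_⟩
  obtain ⟨hfeas, -, hcomp, hstat⟩ := hKKT
  -- Complementary slackness removes the inactive gradients, on which `φ` is unknown, from the
  -- stationarity equation.
  have hφL : φ (gradient L θs) = -∑ i, lam i := by
    have h1 := congrArg φ hstat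
    rw [map_add, map_sum, map_zero] at h1
    have h2 : ∑ i, φ (lam i • gradient (q i) θs) = ∑ i, lam i := by
      refine Finset.sum_congr rfl fun i _ => ?_
      rw [map_smul, smul_eq_mul]
      rcases mul_eq_zero.1 (hcomp i) with h | h
      · rw [h, zero_mul]
      · rw [hφ i h, mul_one]
    linarith
  set B : ℕ → ℝ := fun t => |φ (gradient L (θ t)) + ∑ i, lam i| +
    ∑ i, if q i θs = 0 then |φ (gradient (q i) (θ t)) - 1| else 0 with hB
  have hB0 : Tendsto B atTop (𝓝 0) := by
    have e1 : Tendsto (fun t => |φ (gradient L (θ t)) + ∑ i, lam i|) atTop (𝓝 0) := by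
      have := (((φ.continuous.comp (continuous_gradient hL)).tendsto θs).comp hθ).add_const
        (∑ i, lam i) |>.abs
      simpa [hφL, Function.comp_def] using this
    have e2 : Tendsto (fun t => ∑ i, if q i θs = 0 then |φ (gradient (q i) (θ t)) - 1| else 0)
        atTop (𝓝 (∑ _i : Fin m, 0)) := by
      refine tendsto_finsetSum _ fun i _ => ?_
      by_cases hi : q i θs = 0
      · have := (((φ.continuous.comp (continuous_gradient (hq i))).tendsto θs).comp hθ).sub_const
          1 |>.abs
        simpa [hi, hφ i hi, Function.comp_def] using this
      · simp [hi]
    simpa [hB] using e1.add e2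
  -- Inactive constraints stay strictly satisfied near `θs`, so the first violated constraint is one
  -- that is active at `θs`.
  have hinact : ∀ᶠ t in atTop, ∀ i, q i θs ≠ 0 → q i (θ t) < 0 := by
    rw [eventually_all]
    intro i
    by_cases hi : q i θs = 0
    · exact Eventually.of_forall fun t h => absurd hi h
    · have := (((hq i).continuous.tendsto θs).comp hθ).eventually_lt_const
        (lt_of_le_of_ne (hfeas i) hi)
      exact this.mono fun t ht _ => ht
  refine squeeze_zero_norm' ?_ hB0
  filter_upwards [hinact] with t ht
  have hnn : ∀ i, 0 ≤ (if q i θs = 0 then |φ (gradient (q i) (θ t)) - 1| else 0) := by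
    intro i; split_ifs <;> positivity
  rw [Real.norm_eq_abs]
  by_cases hf : θ t ∈ feasible q
  · rw [switchField_of_mem hf, if_pos hf]
    have e : φ (gradient L (θ t)) - (1 - (1 + ∑ i, lam i) * 1) =
        φ (gradient L (θ t)) + ∑ i, lam i := by ring
    rw [e]
    exact le_add_of_nonneg_right (Finset.sum_nonneg fun i _ => hnn i)
  · rw [switchField_of_notMem hf, if_neg hf, mul_zero, sub_zero]
    obtain ⟨i, hi, hgrad⟩ := exists_isFirstViolated hf
    have hact : q i θs = 0 := by
      by_contra hne
      exact absurd hi.1 (not_lt.2 (ht i hne).le)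
    rw [hgrad]
    have := Finset.single_le_sum (fun i _ => hnn i) (Finset.mem_univ i)
    rw [if_pos hact] at this
    exact this.trans (le_add_of_nonneg_left (abs_nonneg _))

/-! ### From gain-weighted to unweighted proportions -/

namespace Data

open Asymptotics

variable {p m : ℕ} {Ω : Type*} {D : Data p m Ω} {ω : Ω}

open Classical in
/-- `1 - (1 + Λ) 1{θ_t feasible}`: the limiting value of a functional of the field at step `t`. -/
def imbalance (D : Data p m Ω) (ω : Ω) (Λ : ℝ) (t : ℕ) : ℝ :=
  1 - (1 + Λ) * if D.FeasibleAt ω t then 1 else 0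

lemma abs_imbalance_le (Λ : ℝ) (t : ℕ) : |D.imbalance ω Λ t| ≤ 2 + |Λ| := by
  rw [imbalance]
  split_ifs
  · have := abs_nonneg Λ
    rw [mul_one, sub_add_cancel_left, abs_neg]
    linarith
  · simp only [mul_zero, sub_zero, abs_one]
    linarith [abs_nonneg Λ]

/-- Shows the goal of the counting argument: the claimed limit amounts to these sums being `o(t)`.
-/
lemma sum_imbalance (Λ : ℝ) (t : ℕ) :
    ∑ s ∈ Finset.range t, D.imbalance ω Λ s = t - (1 + Λ) * D.spsaCount ω t := by
  classical
  have h := sum_range_feasible (D := D) (ω := ω) (fun _ => (1 : ℝ)) t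
  simp only [Finset.sum_const, Finset.card_range, nsmul_eq_mul, mul_one] at h
  simp only [imbalance]
  rw [Finset.sum_sub_distrib, ← Finset.mul_sum, h]
  simp

lemma sum_stepGain_mul_imbalance (Λ : ℝ) (t : ℕ) :
    ∑ s ∈ Finset.range t, D.stepGain ω s * D.imbalance ω Λ s =
      clock (D.stepGain ω) t - (1 + Λ) * clock D.gainA (D.spsaCount ω t) := by
  classical
  have h := sum_range_feasible (D := D) (ω := ω) D.gainA t
  rw [clock, clock, ← h, Finset.mul_sum, ← Finset.sum_sub_distrib]
  refine Finset.sum_congr rfl fun s _ => ?_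
  rw [imbalance, stepGain]
  split_ifs with hs
  · rw [kappa_of_feasible hs]; ring
  · ring

/-- The weighted proportion of SPSA steps is asymptotically `1 / (1 + Λ)`. -/
lemma isLittleO_sum_stepGain_mul_imbalance [MeasurableSpace Ω] (hD : D.Standing) {θs : Vec p}
    {ζ : ℕ → Vec p} {C : ℝ}
    (H : PerturbedEuler (switchField D.L D.q) (fun t => D.iterate t ω) ζ (D.stepGain ω) C)
    (hθ : Tendsto (fun t => D.iterate t ω) atTop (𝓝 θs)) {lam : Fin m → ℝ}
    (hKKT : IsKKTWith D.L D.q θs lam) (hLICQ : LICQ D.q θs) :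
    (fun t => ∑ s ∈ Finset.range t, D.stepGain ω s * D.imbalance ω (∑ i, lam i) s)
      =o[atTop] clock (D.stepGain ω) := by
  obtain ⟨φ, hφ⟩ := exists_functional_tendsto hD.contDiff_L hD.contDiff_q hKKT hLICQ hθ
  set h := switchField D.L D.q
  -- By telescoping, the sum is the displacement, bounded by convergence, minus the sum of the
  -- perturbations.
  have e1 : (fun t => ∑ s ∈ Finset.range t, D.stepGain ω s • h (D.iterate s ω))
      =o[atTop] clock (D.stepGain ω) := by
    have a1 : (fun t => D.iterate 0 ω - D.iterate t ω) =o[atTop] clock (D.stepGain ω) :=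
      ((tendsto_const_nhds.sub hθ).isBigO_one ℝ).trans_isLittleO
        ((isLittleO_const_left).2 (Or.inr (tendsto_norm_atTop_atTop.comp H.diverges)))
    refine (a1.sub (H.negligible.isLittleO H.pos H.diverges)).congr_left fun t => ?_
    have := H.sub_eq (Nat.zero_le t)
    rw [Finset.range_eq_Ico]
    exact this.symm
  have e2 : (fun t => φ (∑ s ∈ Finset.range t, D.stepGain ω s • h (D.iterate s ω)))
      =o[atTop] clock (D.stepGain ω) := (φ.isBigO_comp _ _).trans_isLittleO e1
  -- Replacing the functional of the field by its asymptotic value costs `o(γ_t)` per step, hence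
  -- `o` of the clock in total.
  have e3 : (fun t => D.stepGain ω t * (φ (h (D.iterate t ω)) - D.imbalance ω (∑ i, lam i) t))
      =o[atTop] D.stepGain ω := by
    have := (isBigO_refl (D.stepGain ω) atTop).mul_isLittleO ((isLittleO_one_iff ℝ).2 hφ)
    simp only [mul_one] at this
    exact this
  have e4 := e3.sum_range (fun t => (H.pos t).le) H.diverges
  refine (e2.sub e4).congr_left fun t => ?_
  rw [map_sum, ← Finset.sum_sub_distrib]
  refine Finset.sum_congr rfl fun s _ => ?_
  rw [map_smul, smul_eq_mul]
  ring

lemma clock_gainA_spsaCount_mono [MeasurableSpace Ω] (hD : D.Standing) :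
    Monotone fun t => clock D.gainA (D.spsaCount ω t) :=
  (clock_mono (gainA_pos hD)).comp spsaCount_mono

/-- As `α < 1`, the sum of the gains is of order `K * a_K`, and `a_K ≤ a_κ` since `κ ≤ K`. The
condition `1 ≤ K` turns `K + 1 + A` into a multiple of `K`. -/
lemma clock_gainA_spsaCount_le [MeasurableSpace Ω] (hD : D.Standing)
    (hα : D.α ∈ Set.Ioo (1 / 2 : ℝ) 1) :
    ∃ c > 0, ∀ t, 1 ≤ D.spsaCount ω t →
      clock D.gainA (D.spsaCount ω t) ≤ c * D.spsaCount ω t * D.gainA (D.kappa t ω) := by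
  have hA := hD.A_nonneg
  have h1 : 0 < 1 - D.α := by linarith [hα.2]
  refine ⟨(2 + D.A) / (1 - D.α), by positivity, fun t ht => ?_⟩
  have hK : (1 : ℝ) ≤ D.spsaCount ω t := by exact_mod_cast ht
  refine (clock_gainA_le hD hα _).trans ?_
  have h2 : D.gainA (D.spsaCount ω t) ≤ D.gainA (D.kappa t ω) :=
    gainA_antitone hD (by linarith [hα.1]) (kappa_le t)
  have h3 : ((D.spsaCount ω t : ℝ) + 1 + D.A) / (1 - D.α) ≤
      (2 + D.A) / (1 - D.α) * D.spsaCount ω t := by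
    rw [div_mul_eq_mul_div]
    refine div_le_div_of_nonneg_right ?_ h1.le
    nlinarith
  exact mul_le_mul h3 h2 (gainA_pos hD _).le (by positivity)

section Asymptotics

variable {Λ : ℝ}

/-- The weighted sum is the clock minus `1 + Λ` times the SPSA clock; being small compared to the
former, it makes the former comparable to the latter. -/
lemma clock_stepGain_isBigO
    (hy : (fun t => ∑ s ∈ Finset.range t, D.stepGain ω s * D.imbalance ω Λ s)
      =o[atTop] clock (D.stepGain ω)) :
    clock (D.stepGain ω) =O[atTop] fun t => clock D.gainA (D.spsaCount ω t) := by
  have h1 := hy.right_isBigO_sub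
  have h2 : (fun t => clock (D.stepGain ω) t -
      ∑ s ∈ Finset.range t, D.stepGain ω s * D.imbalance ω Λ s) =
      fun t => (1 + Λ) * clock D.gainA (D.spsaCount ω t) := by
    funext t
    rw [sum_stepGain_mul_imbalance]
    ring
  rw [h2] at h1
  exact h1.trans (isBigO_const_mul_self _ _ _)

/-- The length of the current inner loop is small compared to the number of SPSA steps. -/
lemma innerCount_isLittleO [MeasurableSpace Ω] (hD : D.Standing) (hα : D.α ∈ Set.Ioo (1 / 2 : ℝ) 1)
    (hy : (fun t => ∑ s ∈ Finset.range t, D.stepGain ω s * D.imbalance ω Λ s)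
      =o[atTop] fun t => clock D.gainA (D.spsaCount ω t))
    (hdiv : Tendsto (fun t => clock D.gainA (D.spsaCount ω t)) atTop atTop)
    (hcount : Tendsto (D.spsaCount ω) atTop atTop) :
    (fun t => (D.innerCount ω t : ℝ)) =o[atTop] fun t => (D.spsaCount ω t : ℝ) := by
  obtain ⟨c, hc, hcle⟩ := clock_gainA_spsaCount_le (ω := ω) hD hα
  rw [isLittleO_iff]
  intro ε hε
  set r := (1 / 2 : ℝ) ^ D.β with hr
  have hr0 : 0 < r := by positivity
  -- The `2` is for the two ends of the loop, `r` for the reduction of the gains, `c` for the bound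
  -- of the SPSA clock by `c * K * a_κ`.
  filter_upwards [eventually_forall_le_of_isLittleO hy (clock_gainA_spsaCount_mono hD) hdiv
    (show 0 < ε * r / (2 * c) by positivity), hcount.eventually_ge_atTop 1] with t h1 h2
  obtain ⟨h3, h4⟩ := innerCount_spec (D := D) (ω := ω) t
  set l := D.innerCount ω t with hl
  have hle : t - l ≤ t := Nat.sub_le _ _
  -- Throughout an inner loop the imbalance is `1`, so the loop raises the weighted sum by its whole
  -- duration.
  have hsum : ∑ s ∈ Finset.Ico (t - l) t, D.stepGain ω s * D.imbalance ω Λ s =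
      ∑ s ∈ Finset.Ico (t - l) t, D.stepGain ω s := by
    refine Finset.sum_congr rfl fun s hs => ?_
    rw [Finset.mem_Ico] at hs
    rw [imbalance, if_neg (h4 s hs.1 hs.2), mul_zero, sub_zero, mul_one]
  have hlow : l * (D.gainA (D.kappa t ω) * r) ≤ ∑ s ∈ Finset.Ico (t - l) t, D.stepGain ω s := by
    have h5 := Finset.card_nsmul_le_sum (Finset.Ico (t - l) t) (D.stepGain ω)
      (D.gainA (D.kappa t ω) * r) (fun s hs => by
        rw [Finset.mem_Ico] at hs
        refine le_trans ?_ (stepGain_bounds hD s).1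
        exact mul_le_mul_of_nonneg_right
          (gainA_antitone hD (by linarith [hα.1]) (kappa_mono hs.2.le)) hr0.le)
    rw [Nat.card_Ico, show t - (t - l) = l by omega, nsmul_eq_mul] at h5
    exact h5
  rw [← hsum, Finset.sum_Ico_eq_sub _ hle] at hlow
  have h6 := abs_le.1 (h1 t le_rfl)
  have h7 := abs_le.1 (h1 (t - l) hle)
  have h8 : (l : ℝ) * (D.gainA (D.kappa t ω) * r) ≤
      ε * D.spsaCount ω t * (D.gainA (D.kappa t ω) * r) := by
    calc (l : ℝ) * (D.gainA (D.kappa t ω) * r)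
        ≤ 2 * (ε * r / (2 * c) * clock D.gainA (D.spsaCount ω t)) := by linarith [h6.2, h7.1]
      _ ≤ 2 * (ε * r / (2 * c) * (c * D.spsaCount ω t * D.gainA (D.kappa t ω))) := by
        have := hcle t h2
        gcongr
      _ = _ := by field_simp
  rw [Real.norm_of_nonneg (Nat.cast_nonneg _), Real.norm_of_nonneg (Nat.cast_nonneg _)]
  exact le_of_mul_le_mul_right h8 (mul_pos (gainA_pos hD _) hr0)

/-- Short inner loops make the reduction factor `(1 - l / (k + 2l + 1)) ^ β` tend to one; at
feasible steps the two gains coincide. -/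
lemma gainA_sub_stepGain_isLittleO [MeasurableSpace Ω] (hD : D.Standing)
    (hl : (fun t => (D.innerCount ω t : ℝ)) =o[atTop] fun t => (D.spsaCount ω t : ℝ)) :
    (fun t => D.gainA (D.kappa t ω) - D.stepGain ω t) =o[atTop] D.stepGain ω := by
  have hr : Tendsto (fun t => (D.innerCount ω t : ℝ) /
      ((D.kappa t ω : ℝ) + 2 * D.innerCount ω t + 1)) atTop (𝓝 0) := by
    have h1 : (fun t => (D.innerCount ω t : ℝ)) =o[atTop]
        fun t => (D.kappa t ω : ℝ) + 2 * D.innerCount ω t + 1 := by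
      refine hl.trans_isBigO (IsBigO.of_bound 1 (Eventually.of_forall fun t => ?_))
      rw [Real.norm_of_nonneg (by positivity), Real.norm_of_nonneg (by positivity), one_mul]
      have h2 : (D.spsaCount ω t : ℝ) ≤ D.kappa t ω + 1 := by
        exact_mod_cast spsaCount_le_kappa_succ (D := D) (ω := ω) t
      have h3 : (0 : ℝ) ≤ D.innerCount ω t := Nat.cast_nonneg _
      linarith
    exact h1.tendsto_div_nhds_zero
  have hpow : Tendsto (fun t => (1 - (D.innerCount ω t : ℝ) /
      ((D.kappa t ω : ℝ) + 2 * D.innerCount ω t + 1)) ^ D.β) atTop (𝓝 1) := by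
    have h1 := (tendsto_const_nhds (x := (1 : ℝ))).sub hr
    rw [sub_zero] at h1
    have h2 := h1.rpow_const (p := D.β) (Or.inl one_ne_zero)
    rwa [Real.one_rpow] at h2
  have hsub : (fun t => 1 - (1 - (D.innerCount ω t : ℝ) /
      ((D.kappa t ω : ℝ) + 2 * D.innerCount ω t + 1)) ^ D.β) =o[atTop] fun _ => (1 : ℝ) := by
    rw [isLittleO_one_iff]
    simpa using (tendsto_const_nhds (x := (1 : ℝ))).sub hpow
  have hb : (fun t => D.gainA (D.kappa t ω)) =O[atTop] D.stepGain ω := by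
    refine IsBigO.of_bound ((1 / 2 : ℝ) ^ D.β)⁻¹ (Eventually.of_forall fun t => ?_)
    rw [Real.norm_of_nonneg (gainA_pos hD _).le, Real.norm_of_nonneg (stepGain_pos hD t).le,
      inv_mul_eq_div, le_div_iff₀ (by positivity)]
    exact (stepGain_bounds hD t).1
  have hmul : (fun t => D.gainA (D.kappa t ω) * (1 - (1 - (D.innerCount ω t : ℝ) /
      ((D.kappa t ω : ℝ) + 2 * D.innerCount ω t + 1)) ^ D.β)) =o[atTop] D.stepGain ω := by
    simpa only [mul_one] using hb.mul_isLittleO hsub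
  refine (IsBigO.of_bound 1 (Eventually.of_forall fun t => ?_)).trans_isLittleO hmul
  rw [one_mul, stepGain]
  split_ifs
  · rw [sub_self, norm_zero]; exact norm_nonneg _
  · rw [innerGain_eq, mul_sub, mul_one]

/-- Once the iterates converge to a KKT point, the proportion of SPSA steps is determined by the
multipliers. -/
theorem tendsto_measurementProportion [MeasurableSpace Ω] (hD : D.Standing)
    (hα : D.α ∈ Set.Ioo (1 / 2 : ℝ) 1)
    (hsum : Tendsto (clock D.gainA) atTop atTop)
    (hκ : Tendsto (fun t => D.kappa t ω) atTop atTop) {θs : Vec p} {ζ : ℕ → Vec p} {C : ℝ}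
    (H : PerturbedEuler (switchField D.L D.q) (fun t => D.iterate t ω) ζ (D.stepGain ω) C)
    (hθ : Tendsto (fun t => D.iterate t ω) atTop (𝓝 θs)) {lam : Fin m → ℝ}
    (hKKT : IsKKTWith D.L D.q θs lam) (hLICQ : LICQ D.q θs) :
    Tendsto (fun t => D.measurementProportion t ω) atTop (𝓝 (1 / (1 + ∑ i, lam i))) := by
  set Λ := ∑ i, lam i with hΛ
  have hΛ0 : 0 ≤ Λ := Finset.sum_nonneg fun i _ => hKKT.2.1 i
  have hcount := tendsto_spsaCount hκ
  have hdiv : Tendsto (fun t => clock D.gainA (D.spsaCount ω t)) atTop atTop := hsum.comp hcount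
  have hy := isLittleO_sum_stepGain_mul_imbalance hD H hθ hKKT hLICQ
  have hO := clock_stepGain_isBigO hy
  have hy' := hy.trans_isBigO hO
  have hl := innerCount_isLittleO hD hα hy' hdiv hcount
  -- The weights are exchanged for `a_κ`, whose monotonicity in `t` partial summation requires.
  have hdiff : (fun t => ∑ s ∈ Finset.range t,
      (D.gainA (D.kappa s ω) - D.stepGain ω s) * D.imbalance ω Λ s) =o[atTop]
      fun t => clock D.gainA (D.spsaCount ω t) := by
    refine IsLittleO.trans_isBigO ?_ hO
    have h1 : (fun t => D.imbalance ω Λ t) =O[atTop] fun _ => (1 : ℝ) :=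
      IsBigO.of_bound (2 + |Λ|) (Eventually.of_forall fun t => by
        rw [Real.norm_eq_abs, norm_one, mul_one]; exact abs_imbalance_le Λ t)
    have h2 := (gainA_sub_stepGain_isLittleO hD hl).mul_isBigO h1
    simp only [mul_one] at h2
    exact h2.sum_range (fun t => (H.pos t).le) H.diverges
  have hb : (fun t => ∑ s ∈ Finset.range t, D.gainA (D.kappa s ω) * D.imbalance ω Λ s) =o[atTop]
      fun t => clock D.gainA (D.spsaCount ω t) := by
    refine (hdiff.add hy').congr_left fun t => ?_
    rw [← Finset.sum_add_distrib]
    refine Finset.sum_congr rfl fun s _ => ?_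
    ring
  obtain ⟨c, hc, hcle⟩ := clock_gainA_spsaCount_le (ω := ω) hD hα
  have hy1 := isLittleO_sum_of_weighted (fun t => gainA_pos hD (D.kappa t ω))
    (fun s t hst => gainA_antitone hD (by linarith [hα.1]) (kappa_mono hst)) hb
    (clock_gainA_spsaCount_mono hD) hdiv (c := c) (by
      filter_upwards [hcount.eventually_ge_atTop 1] with t ht
      refine (hcle t ht).trans ?_
      have h1 : (D.spsaCount ω t : ℝ) ≤ t := by exact_mod_cast spsaCount_le (D := D) (ω := ω) t
      have h2 := gainA_pos hD (D.kappa t ω)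
      gcongr)
  have h1 := hy1.tendsto_div_nhds_zero
  have h2 : Tendsto (fun t : ℕ => (1 - (∑ s ∈ Finset.range t, D.imbalance ω Λ s) / (t : ℝ)) /
      (1 + Λ)) atTop (𝓝 (1 / (1 + Λ))) := by
    have := ((tendsto_const_nhds (x := (1 : ℝ))).sub h1).div_const (1 + Λ)
    rwa [sub_zero] at this
  refine h2.congr' ?_
  filter_upwards [eventually_gt_atTop 0] with t ht
  have ht' : (t : ℝ) ≠ 0 := by positivity
  have hΛ1 : (1 + Λ) ≠ 0 := by positivity
  rw [sum_imbalance, measurementProportion_eq]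
  field_simp
  ring

end Asymptotics

end Data

/-! ### Square-integrable martingales -/

section Martingale

variable {Ω : Type*} [mΩ : MeasurableSpace Ω] {μ : Measure Ω} [IsProbabilityMeasure μ]

/-- A series of martingale differences with summable second moments converges almost surely. -/
lemma ae_tendsto_sum_of_martingale_difference (ℱ : Filtration ℕ mΩ) {Y : ℕ → Ω → ℝ}
    (hmeas : ∀ k, StronglyMeasurable[ℱ (k + 1)] (Y k)) (hL2 : ∀ k, MemLp (Y k) 2 μ)
    (hcond : ∀ k, μ[Y k | ℱ k] =ᵐ[μ] 0) {v : ℕ → ℝ} (hv : ∀ k, ∫ ω, Y k ω ^ 2 ∂μ ≤ v k)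
    (hsum : Summable v) :
    ∀ᵐ ω ∂μ, ∃ l, Tendsto (fun n => ∑ k ∈ Finset.range n, Y k ω) atTop (𝓝 l) := by
  set S : ℕ → Ω → ℝ := fun n => ∑ k ∈ Finset.range n, Y k with hS
  have hSsucc : ∀ n, S (n + 1) = S n + Y n := fun n => Finset.sum_range_succ _ _
  have hadp : ∀ n, StronglyMeasurable[ℱ n] (S n) := fun n =>
    Finset.stronglyMeasurable_sum _ fun k hk =>
      (hmeas k).mono (ℱ.mono (Nat.succ_le_of_lt (Finset.mem_range.1 hk)))
  have hSL2 : ∀ n, MemLp (S n) 2 μ := fun n => memLp_finsetSum' _ fun k _ => hL2 k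
  have hSint : ∀ n, Integrable (S n) μ := fun n => (hSL2 n).integrable one_le_two
  have hmart : Martingale S ℱ μ := by
    refine martingale_of_condExp_sub_eq_zero_nat hadp hSint fun n => ?_
    rw [hSsucc, add_sub_cancel_left]
    exact hcond n
  have horth : ∀ n, ∫ ω, S n ω * Y n ω ∂μ = 0 := by
    intro n
    have h1 : Integrable (S n * Y n) μ := (hSL2 n).integrable_mul (hL2 n)
    have h2 := condExp_mul_of_stronglyMeasurable_left (hadp n) h1
      ((hL2 n).integrable one_le_two)
    have h3 : ∫ ω, (S n * Y n) ω ∂μ = ∫ ω, μ[S n * Y n | ℱ n] ω ∂μ :=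
      (integral_condExp (ℱ.le n)).symm
    have h4 : μ[S n * Y n | ℱ n] =ᵐ[μ] 0 := by
      filter_upwards [h2, hcond n] with ω h5 h6
      rw [h5, Pi.mul_apply, h6]
      simp
    rw [integral_congr_ae h4] at h3
    simpa using h3
  have hsq : ∀ n, ∫ ω, S n ω ^ 2 ∂μ = ∑ k ∈ Finset.range n, ∫ ω, Y k ω ^ 2 ∂μ := by
    intro n
    induction n with
    | zero => simp [hS]
    | succ n ih =>
      rw [Finset.sum_range_succ, ← ih]
      have h1 : ∀ ω, S (n + 1) ω ^ 2 = S n ω ^ 2 + 2 * (S n ω * Y n ω) + Y n ω ^ 2 := by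
        intro ω
        rw [hSsucc, Pi.add_apply]
        ring
      have i1 := (hSL2 n).integrable_sq
      have i2 : Integrable (fun ω => 2 * (S n ω * Y n ω)) μ :=
        ((hSL2 n).integrable_mul (hL2 n)).const_mul 2
      have i3 := (hL2 n).integrable_sq
      have i12 : Integrable (fun ω => S n ω ^ 2 + 2 * (S n ω * Y n ω)) μ := i1.add i2
      simp only [h1]
      rw [integral_add i12 i3, integral_add i1 i2, integral_const_mul, horth]
      ring
  have hbound : ∀ n, ∫ ω, S n ω ^ 2 ∂μ ≤ ∑' k, v k := by
    intro n
    rw [hsq]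
    refine (Finset.sum_le_sum fun k _ => hv k).trans (hsum.sum_le_tsum _ fun k _ => ?_)
    exact (integral_nonneg fun ω => sq_nonneg _).trans (hv k)
  -- `|x| ≤ 1 + x ^ 2` turns the `L²` bound into the `L¹` bound of the martingale convergence
  -- theorem.
  have hL1 : ∀ n, eLpNorm (S n) 1 μ ≤ ((1 + ∑' k, v k).toNNReal : ℝ≥0∞) := by
    intro n
    rw [eLpNorm_one_eq_lintegral_enorm, ← ofReal_integral_norm_eq_lintegral_enorm (hSint n)]
    refine ENNReal.ofReal_le_ofReal ?_
    have h1 : ∫ ω, ‖S n ω‖ ∂μ ≤ ∫ ω, (1 + S n ω ^ 2) ∂μ := by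
      refine integral_mono (hSint n).norm ((integrable_const _).add (hSL2 n).integrable_sq) ?_
      intro ω
      change ‖S n ω‖ ≤ 1 + S n ω ^ 2
      rw [Real.norm_eq_abs, ← sq_abs]
      nlinarith [sq_nonneg (|S n ω| - 1), abs_nonneg (S n ω)]
    rw [integral_add (integrable_const _) (hSL2 n).integrable_sq] at h1
    simp only [integral_const, probReal_univ, smul_eq_mul, one_mul] at h1
    linarith [hbound n]
  filter_upwards [hmart.submartingale.ae_tendsto_limitProcess hL1] with ω hω
  refine ⟨_, hω.congr fun n => ?_⟩
  simp only [hS, Finset.sum_apply]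

/-- The martingale differences `a_k G_k X_k`, with `G_k` bounded and known in advance and `X_k`
fresh and centered. -/
lemma ae_tendsto_sum_of_fresh (ℱ : Filtration ℕ mΩ) {a : ℕ → ℝ} {G X : ℕ → Ω → ℝ}
    {𝒢 : ℕ → MeasurableSpace Ω} (h𝒢 : ∀ k, 𝒢 k ≤ ℱ (k + 1))
    (hind : ∀ k, Indep (𝒢 k) (ℱ k) μ) (hX : ∀ k, StronglyMeasurable[𝒢 k] (X k))
    (hXL2 : ∀ k, MemLp (X k) 2 μ) (hX0 : ∀ k, ∫ ω, X k ω ∂μ = 0)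
    {B : ℝ} (hXB : ∀ k, ∫ ω, X k ω ^ 2 ∂μ ≤ B)
    (hG : ∀ k, StronglyMeasurable[ℱ k] (G k)) {M : ℝ} (hGM : ∀ k ω, |G k ω| ≤ M)
    (ha : Summable fun k => a k ^ 2) :
    ∀ᵐ ω ∂μ, ∃ l, Tendsto (fun n => ∑ k ∈ Finset.range n, a k * (G k ω * X k ω)) atTop
      (𝓝 l) := by
  have hL2 : ∀ k, MemLp (fun ω => a k * (G k ω * X k ω)) 2 μ := by
    intro k
    refine MemLp.const_mul ?_ (a k)
    refine (hXL2 k).of_le_mul (c := M) (((hG k).mono (ℱ.le k)).aestronglyMeasurable.mul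
      (hXL2 k).1) (Eventually.of_forall fun ω => ?_)
    rw [norm_mul]
    exact mul_le_mul_of_nonneg_right (hGM k ω) (norm_nonneg _)
  refine ae_tendsto_sum_of_martingale_difference ℱ (v := fun k => a k ^ 2 * (M ^ 2 * B))
    (fun k => ?_) hL2 (fun k => ?_) (fun k => ?_) (ha.mul_right _)
  · exact (((hG k).mono (ℱ.mono (Nat.le_succ k))).mul ((hX k).mono (h𝒢 k))).const_mul (a k)
  · have hGX : Integrable (G k * X k) μ :=
      ((hXL2 k).integrable one_le_two).bdd_mul
        ((hG k).mono (ℱ.le k)).aestronglyMeasurable (Eventually.of_forall fun ω => hGM k ω)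
    have h1 := condExp_mul_of_stronglyMeasurable_left (hG k) hGX
      ((hXL2 k).integrable one_le_two)
    have h2 := condExp_indep_eq ((h𝒢 k).trans (ℱ.le _)) (ℱ.le k) (hX k) (hind k)
    have h3 : μ[fun ω => a k * (G k ω * X k ω) | ℱ k] =ᵐ[μ] a k • μ[G k * X k | ℱ k] :=
      condExp_smul (a k) (G k * X k) (ℱ k)
    filter_upwards [h1, h2, h3] with ω e1 e2 e3
    rw [e3, Pi.smul_apply, e1, Pi.mul_apply, e2, hX0 k]
    simp
  · have h1 : ∀ ω, (a k * (G k ω * X k ω)) ^ 2 ≤ a k ^ 2 * (M ^ 2 * X k ω ^ 2) := by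
      intro ω
      have h2 : G k ω ^ 2 ≤ M ^ 2 := sq_le_sq' (abs_le.1 (hGM k ω)).1 (abs_le.1 (hGM k ω)).2
      rw [mul_pow, mul_pow]
      gcongr
    refine (integral_mono (hL2 k).integrable_sq
      (((hXL2 k).integrable_sq.const_mul _).const_mul _) h1).trans ?_
    rw [integral_const_mul, integral_const_mul]
    have := hXB k
    gcongr

end Martingale

/-! ### Operations on negligible perturbations -/

section Negligible

variable {E : Type*} [NormedAddCommGroup E] {a : ℕ → ℝ}

lemma negligibleSum_zero (ha : ∀ k, 0 ≤ a k) : NegligibleSum a (fun _ => (0 : E)) := by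
  intro ε hε
  refine ⟨0, fun n _ m _ => ?_⟩
  have := Finset.sum_nonneg fun k (_ : k ∈ Finset.Ico n m) => ha k
  simp only [Finset.sum_const_zero, norm_zero]
  positivity

lemma NegligibleSum.add {ζ ξ : ℕ → E} (h1 : NegligibleSum a ζ) (h2 : NegligibleSum a ξ) :
    NegligibleSum a (fun k => ζ k + ξ k) := by
  intro ε hε
  obtain ⟨n₁, hn₁⟩ := h1 (ε / 2) (half_pos hε)
  obtain ⟨n₂, hn₂⟩ := h2 (ε / 2) (half_pos hε)
  refine ⟨max n₁ n₂, fun n hn m hm => ?_⟩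
  have e1 := hn₁ n ((le_max_left _ _).trans hn) m hm
  have e2 := hn₂ n ((le_max_right _ _).trans hn) m hm
  rw [Finset.sum_add_distrib]
  refine (norm_add_le _ _).trans ?_
  linarith

lemma negligibleSum_sum {ι : Type*} (s : Finset ι) (ha : ∀ k, 0 ≤ a k) {ζ : ι → ℕ → E}
    (h : ∀ i ∈ s, NegligibleSum a (ζ i)) : NegligibleSum a (fun k => ∑ i ∈ s, ζ i k) := by
  classical
  induction s using Finset.induction_on with
  | empty => simpa using negligibleSum_zero ha
  | insert i s hi ih =>
    simp only [Finset.sum_insert hi]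
    exact (h i (Finset.mem_insert_self i s)).add
      (ih fun j hj => h j (Finset.mem_insert_of_mem hj))

/-- Cauchy's criterion; only the constant term of `NegligibleSum` is used. -/
lemma negligibleSum_of_tendsto (ha : ∀ k, 0 ≤ a k) {ζ : ℕ → E}
    (h : ∃ l, Tendsto (fun n => ∑ k ∈ Finset.range n, ζ k) atTop (𝓝 l)) : NegligibleSum a ζ := by
  intro ε hε
  obtain ⟨l, hl⟩ := h
  obtain ⟨n₀, hn₀⟩ := Metric.cauchySeq_iff.1 hl.cauchySeq ε hε
  refine ⟨n₀, fun n hn m hm => ?_⟩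
  have h1 := hn₀ m (hn.trans hm) n hn
  rw [dist_eq_norm, ← Finset.sum_Ico_eq_sub _ hm] at h1
  have h2 := Finset.sum_nonneg fun k (_ : k ∈ Finset.Ico n m) => ha k
  nlinarith

/-- Terms that are small relative to `b`, where `b` is of the order of `a` up to a negligible
perturbation. -/
lemma negligibleSum_of_small (ha : ∀ k, 0 ≤ a k) {ζ : ℕ → E} {η b w : ℕ → ℝ}
    (hη : Tendsto η atTop (𝓝 0)) (hζ : ∀ k, ‖ζ k‖ ≤ η k * b k) (hb : ∀ k, 0 ≤ b k) {B : ℝ}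
    (hB : 0 ≤ B) (hbw : ∀ k, b k ≤ B * a k + w k) (hw : NegligibleSum a w) :
    NegligibleSum a ζ := by
  intro ε hε
  -- Level `1` is enough for `w`: it bounds window sums of `b` by `(B + 1)(1 + ∑ a)`, and smallness
  -- comes from `η`.
  obtain ⟨n₁, hn₁⟩ := hw 1 one_pos
  obtain ⟨n₂, hn₂⟩ := eventually_atTop.1
    (hη.eventually_lt_const (show 0 < ε / (B + 1) by positivity))
  refine ⟨max n₁ n₂, fun n hn m hm => ?_⟩
  have e1 := hn₁ n ((le_max_left _ _).trans hn) m hm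
  have h2 := Finset.sum_nonneg fun k (_ : k ∈ Finset.Ico n m) => ha k
  calc ‖∑ k ∈ Finset.Ico n m, ζ k‖ ≤ ∑ k ∈ Finset.Ico n m, ε / (B + 1) * b k := by
        refine norm_sum_le_of_le _ fun k hk => (hζ k).trans ?_
        exact mul_le_mul_of_nonneg_right (hn₂ k (((le_max_right _ _).trans hn).trans
          (Finset.mem_Ico.1 hk).1)).le (hb k)
    _ ≤ ε / (B + 1) * (B * ∑ k ∈ Finset.Ico n m, a k + ∑ k ∈ Finset.Ico n m, w k) := by
        rw [← Finset.mul_sum, Finset.mul_sum (a := B), ← Finset.sum_add_distrib]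
        exact mul_le_mul_of_nonneg_left (Finset.sum_le_sum fun k _ => hbw k) (by positivity)
    _ ≤ ε / (B + 1) * ((B + 1) * (1 + ∑ k ∈ Finset.Ico n m, a k)) := by
        refine mul_le_mul_of_nonneg_left ?_ (by positivity)
        have := le_abs_self (∑ k ∈ Finset.Ico n m, w k)
        rw [Real.norm_eq_abs] at e1
        nlinarith
    _ = _ := by field_simp

lemma negligibleSum_vec {p : ℕ} (ha : ∀ k, 0 ≤ a k) {ζ : ℕ → Vec p}
    (h : ∀ j, NegligibleSum a (fun k => ζ k j)) : NegligibleSum a ζ := by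
  have h1 : ∀ j : Fin p, NegligibleSum a
      (fun k => ζ k j • (EuclideanSpace.basisFun (Fin p) ℝ j : Vec p)) := by
    intro j ε hε
    obtain ⟨n₀, hn₀⟩ := h j ε hε
    refine ⟨n₀, fun n hn m hm => ?_⟩
    rw [← Finset.sum_smul, norm_smul, OrthonormalBasis.norm_eq_one, mul_one]
    exact hn₀ n hn m hm
  have h2 := negligibleSum_sum Finset.univ ha (fun j _ => h1 j)
  have h3 : (fun k => ∑ j, ζ k j • (EuclideanSpace.basisFun (Fin p) ℝ j : Vec p)) = ζ := by
    funext k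
    have := (EuclideanSpace.basisFun (Fin p) ℝ).sum_repr (ζ k)
    simpa using this
  rwa [h3] at h2

end Negligible

/-! ### Bias of symmetric difference quotients -/

lemma fderiv_apply_eq_sum_gradient {p : ℕ} (f : Vec p → ℝ) (x v : Vec p) :
    fderiv ℝ f x v = ∑ i, gradient f x i * v i := by
  have h : fderiv ℝ f x v = inner ℝ (gradient f x) v :=
    (InnerProductSpace.toDual_symm_apply (𝕜 := ℝ) (E := Vec p)).symm
  rw [h, PiLp.inner_apply]
  refine Finset.sum_congr rfl fun i _ => ?_
  simp [mul_comm]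

/-- Symmetric difference quotients in bounded directions at bounded points approximate the
directional derivatives uniformly. -/
lemma tendsto_symmetric_difference {p : ℕ} {f : Vec p → ℝ} (hf : ContDiff ℝ 1 f)
    {x d : ℕ → Vec p} {c : ℕ → ℝ} (hc : ∀ k, 0 < c k) (hc0 : Tendsto c atTop (𝓝 0))
    {R B : ℝ} (hx : ∀ k, ‖x k‖ ≤ R) (hd : ∀ k, ‖d k‖ ≤ B) :
    Tendsto (fun k => (f (x k + c k • d k) - f (x k - c k • d k)) / (2 * c k) -
      ∑ i, gradient f (x k) i * d k i) atTop (𝓝 0) := by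
  have hB : 0 ≤ B := (norm_nonneg _).trans (hd 0)
  have huc : UniformContinuousOn (fderiv ℝ f) (Metric.closedBall (0 : Vec p) (R + 1)) :=
    (isCompact_closedBall _ _).uniformContinuousOn_of_continuous
      (hf.continuous_fderiv one_ne_zero).continuousOn
  rw [Metric.tendsto_nhds]
  intro ε hε
  obtain ⟨δ, hδ, hδε⟩ := Metric.uniformContinuousOn_iff.1 huc (ε / (B + 1)) (by positivity)
  have hcB : Tendsto (fun k => c k * B) atTop (𝓝 0) := by simpa using hc0.mul_const B
  -- `1` keeps the segment in the ball of radius `R + 1`, `δ` keeps the derivative nearly constant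
  -- on it.
  filter_upwards [hcB.eventually_lt_const (lt_min hδ one_pos)] with k hk
  obtain ⟨hk1, hk2⟩ := lt_min_iff.1 hk
  have hmem : ∀ z ∈ Metric.closedBall (x k) (c k * B),
      z ∈ Metric.closedBall (0 : Vec p) (R + 1) := by
    intro z hz
    rw [Metric.mem_closedBall, dist_eq_norm] at hz
    rw [mem_closedBall_zero_iff]
    have h1 := norm_add_le (z - x k) (x k)
    rw [sub_add_cancel] at h1
    linarith [hx k]
  have hu : ‖c k • d k‖ ≤ c k * B := by
    rw [norm_smul, Real.norm_of_nonneg (hc k).le]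
    exact mul_le_mul_of_nonneg_left (hd k) (hc k).le
  have hmv := (convex_closedBall (x k) (c k * B)).norm_image_sub_le_of_norm_hasFDerivWithin_le'
    (f := f) (f' := fderiv ℝ f) (φ := fderiv ℝ f (x k)) (C := ε / (B + 1))
    (x := x k - c k • d k) (y := x k + c k • d k)
    (fun z _ => (hf.differentiable one_ne_zero z).hasFDerivAt.hasFDerivWithinAt)
    (fun z hz => by
      have := hδε z (hmem z hz) (x k) (hmem _ (Metric.mem_closedBall_self
        (mul_nonneg (hc k).le hB))) ((Metric.mem_closedBall.1 hz).trans_lt hk1)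
      rw [dist_eq_norm] at this
      exact this.le)
    (by simpa [dist_eq_norm] using hu) (by simpa [dist_eq_norm] using hu)
  have e1 : x k + c k • d k - (x k - c k • d k) = (2 * c k) • d k := by
    rw [mul_smul, two_smul]; abel
  have h2c : 0 < 2 * c k := by linarith [hc k]
  rw [e1, map_smul, smul_eq_mul, norm_smul, Real.norm_of_nonneg h2c.le,
    fderiv_apply_eq_sum_gradient] at hmv
  rw [dist_zero_right]
  have e2 : (f (x k + c k • d k) - f (x k - c k • d k)) / (2 * c k) -
      ∑ i, gradient f (x k) i * d k i = (f (x k + c k • d k) - f (x k - c k • d k) -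
      2 * c k * ∑ i, gradient f (x k) i * d k i) / (2 * c k) := by
    rw [sub_div _ (2 * c k * _), mul_div_cancel_left₀ _ h2c.ne']
  rw [e2, norm_div, Real.norm_of_nonneg h2c.le, div_lt_iff₀ h2c]
  refine hmv.trans_lt ?_
  have h3 : ε / (B + 1) * ‖d k‖ < ε := by
    rw [div_mul_eq_mul_div, div_lt_iff₀ (by positivity)]
    have := hd k
    nlinarith
  nlinarith

/-! ### Errors of the gradient estimates; the run as an Euler scheme -/

namespace Data

variable {p m : ℕ} {Ω : Type*} {D : Data p m Ω} {ω : Ω}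

/-- Separates the errors by their cure: cross terms are centered by symmetry, measurement noise by
assumption, and the last term carries a bias tending to zero. -/
lemma gradEstimate_sub_apply {k : ℕ} {j : Fin p} (hj : D.Δ k ω j ≠ 0) (x g : Vec p) :
    D.gradEstimate k x ω j - g j =
      ∑ i ∈ Finset.univ.erase j, g i * (D.Δ k ω i / D.Δ k ω j) +
      1 / (2 * D.gainC k) * ((D.εp k ω - D.εm k ω) / D.Δ k ω j) +
      ((D.L (x + D.gainC k • D.Δ k ω) - D.L (x - D.gainC k • D.Δ k ω)) / (2 * D.gainC k) -
        ∑ i, g i * D.Δ k ω i) / D.Δ k ω j := by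
  have h1 : ∑ i, g i * D.Δ k ω i = g j * D.Δ k ω j +
      ∑ i ∈ Finset.univ.erase j, g i * D.Δ k ω i :=
    (Finset.add_sum_erase _ _ (Finset.mem_univ j)).symm
  have h2 : ∑ i ∈ Finset.univ.erase j, g i * (D.Δ k ω i / D.Δ k ω j) =
      (∑ i ∈ Finset.univ.erase j, g i * D.Δ k ω i) / D.Δ k ω j := by
    rw [Finset.sum_div]
    exact Finset.sum_congr rfl fun i _ => by ring
  have h3 : D.gradEstimate k x ω j = ((D.L (x + D.gainC k • D.Δ k ω) + D.εp k ω) -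
      (D.L (x - D.gainC k • D.Δ k ω) + D.εm k ω)) / (2 * D.gainC k * D.Δ k ω j) := rfl
  rw [h1, h2, h3]
  simp only [div_eq_mul_inv, mul_inv]
  linear_combination g j * mul_inv_cancel₀ hj

/-- The weighted errors of the gradient estimates are negligible if the martingale parts
converge. -/
lemma negligibleSum_gradEstimate (hL : ContDiff ℝ 1 D.L) (ha : ∀ k, 0 ≤ D.gainA k)
    (hc : ∀ k, 0 < D.gainC k) (hc0 : Tendsto D.gainC atTop (𝓝 0)) {x : ℕ → Vec p} {R B M : ℝ}
    (hx : ∀ k, ‖x k‖ ≤ R) (hΔ0 : ∀ k j, D.Δ k ω j ≠ 0) (hΔB : ∀ k, ‖D.Δ k ω‖ ≤ B)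
    {e : ℕ → Fin p → ℝ} (he : ∀ k j, e k j ≤ M) (hM : 0 ≤ M)
    (hcross : ∀ j i, i ≠ j → ∃ l, Tendsto (fun n => ∑ k ∈ Finset.range n,
      D.gainA k * (gradient D.L (x k) i * (D.Δ k ω i / D.Δ k ω j))) atTop (𝓝 l))
    (hinv : ∀ j, ∃ l, Tendsto (fun n => ∑ k ∈ Finset.range n,
      D.gainA k * (1 * (|D.Δ k ω j|⁻¹ - e k j))) atTop (𝓝 l))
    (hnoise : ∀ j, ∃ l, Tendsto (fun n => ∑ k ∈ Finset.range n,
      D.gainA k / (2 * D.gainC k) * ((D.εp k ω - D.εm k ω) / D.Δ k ω j)) atTop (𝓝 l)) :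
    NegligibleSum D.gainA
      (fun k => D.gainA k • (D.gradEstimate k (x k) ω - gradient D.L (x k))) := by
  refine negligibleSum_vec ha fun j => ?_
  set r : ℕ → ℝ := fun k => (D.L (x k + D.gainC k • D.Δ k ω) -
    D.L (x k - D.gainC k • D.Δ k ω)) / (2 * D.gainC k) -
      ∑ i, gradient D.L (x k) i * D.Δ k ω i with hr
  have hr0 : Tendsto r atTop (𝓝 0) := tendsto_symmetric_difference hL hc hc0 hx hΔB
  have h1 : NegligibleSum D.gainA (fun k => ∑ i ∈ Finset.univ.erase j,
      D.gainA k * (gradient D.L (x k) i * (D.Δ k ω i / D.Δ k ω j))) :=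
    negligibleSum_sum _ ha fun i hi => negligibleSum_of_tendsto ha
      (hcross j i (Finset.ne_of_mem_erase hi))
  have h2 := negligibleSum_of_tendsto ha (hnoise j)
  -- `1 / |Δ_kj|` need not be bounded, so a vanishing bias is not enough by itself; but `a_k /
  -- |Δ_kj|` is at most `M * a_k` plus the term of a convergent series.
  have h3 : NegligibleSum D.gainA (fun k => D.gainA k * (r k / D.Δ k ω j)) := by
    refine negligibleSum_of_small ha (η := fun k => |r k|)
      (b := fun k => D.gainA k * |D.Δ k ω j|⁻¹) (by simpa using hr0.abs) (fun k => ?_)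
      (fun k => mul_nonneg (ha k) (by positivity)) hM (fun k => ?_)
      (negligibleSum_of_tendsto ha (hinv j))
    · rw [norm_mul, norm_div, Real.norm_of_nonneg (ha k), Real.norm_eq_abs, Real.norm_eq_abs]
      exact le_of_eq (by ring)
    · have := mul_le_mul_of_nonneg_left (he k j) (ha k)
      linarith
  have h4 := (h1.add h2).add h3
  refine (congrArg (NegligibleSum D.gainA) (funext fun k => ?_)).mpr h4
  change D.gainA k * (D.gradEstimate k (x k) ω j - gradient D.L (x k) j) = _
  rw [gradEstimate_sub_apply (hΔ0 k j), ← Finset.mul_sum]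
  ring

/-- A run of the SU algorithm with bounded iterates and negligible errors is a perturbed Euler
scheme for the switching field. -/
lemma exists_perturbedEuler [MeasurableSpace Ω] (hD : D.Standing)
    (ha0 : Tendsto D.gainA atTop (𝓝 0)) (hsum : Tendsto (clock D.gainA) atTop atTop)
    (hκ : Tendsto (fun t => D.kappa t ω) atTop atTop) {R : ℝ} (hR : ∀ t, ‖D.iterate t ω‖ ≤ R)
    {x : ℕ → Vec p} (hx : ∀ t, D.FeasibleAt ω t → x (D.spsaCount ω t) = D.iterate t ω)
    (hneg : NegligibleSum D.gainA
      (fun k => D.gainA k • (D.gradEstimate k (x k) ω - gradient D.L (x k)))) :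
    ∃ ζ C, PerturbedEuler (switchField D.L D.q) (fun t => D.iterate t ω) ζ (D.stepGain ω) C := by
  classical
  have hcompact := isCompact_closedBall (0 : Vec p) R
  have hmem : ∀ t, D.iterate t ω ∈ Metric.closedBall (0 : Vec p) R := fun t => by simpa using hR t
  obtain ⟨M, hM⟩ := hcompact.exists_bound_of_continuousOn
    (continuous_gradient hD.contDiff_L).continuousOn
  have hN : ∀ i, ∃ N, ∀ z ∈ Metric.closedBall (0 : Vec p) R, ‖gradient (D.q i) z‖ ≤ N := fun i =>
    hcompact.exists_bound_of_continuousOn (continuous_gradient (hD.contDiff_q i)).continuousOn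
  choose N hN using hN
  have hN0 : ∀ i, 0 ≤ N i := fun i => (norm_nonneg _).trans (hN i _ (hmem 0))
  have hM0 : 0 ≤ M := (norm_nonneg _).trans (hM _ (hmem 0))
  refine ⟨fun t => if D.FeasibleAt ω t then (fun k => D.gainA k •
    (D.gradEstimate k (x k) ω - gradient D.L (x k))) (D.spsaCount ω t) else 0, M + ∑ i, N i,
    ⟨fun t => ?_, fun t => stepGain_pos hD t, ?_, ?_, ?_, fun t => ?_⟩⟩
  · by_cases h : D.FeasibleAt ω t
    · have h' : D.iterate t ω ∈ feasible D.q := h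
      simp only [if_pos h, hx t h]
      rw [iterate_succ_of_feasible h, stepGain, if_pos h, kappa_of_feasible h,
        switchField_of_mem h', smul_sub]
      abel
    · have h' : D.iterate t ω ∉ feasible D.q := h
      rw [if_neg h, iterate_succ_of_not_feasible h, stepGain, if_neg h, switchField_of_notMem h',
        sub_zero]
  · exact squeeze_zero (fun t => (stepGain_pos hD t).le) (fun t => (stepGain_bounds hD t).2)
      (ha0.comp hκ)
  · exact tendsto_atTop_mono (clock_gainA_le_clock_stepGain hD)
      (hsum.comp (tendsto_spsaCount hκ))
  -- A window of steps corresponds to a window of SPSA indices, whose total gain is at most the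
  -- duration of the former.
  · intro ε hε
    obtain ⟨n₀, hn₀⟩ := hneg ε hε
    obtain ⟨t₀, ht₀⟩ := eventually_atTop.1 ((tendsto_spsaCount hκ).eventually_ge_atTop n₀)
    refine ⟨t₀, fun n hn t ht => ?_⟩
    have hZ := sum_Ico_feasible (D := D) (ω := ω) (fun k => D.gainA k •
      (D.gradEstimate k (x k) ω - gradient D.L (x k))) ht
    refine (congrArg norm hZ).trans_le ?_
    refine (hn₀ _ (ht₀ n hn) _ (spsaCount_mono ht)).trans ?_
    have := sum_Ico_gainA_le (ω := ω) hD ht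
    gcongr
  · by_cases h' : D.iterate t ω ∈ feasible D.q
    · rw [switchField_of_mem h']
      exact (hM _ (hmem t)).trans (le_add_of_nonneg_right (Finset.sum_nonneg fun i _ => hN0 i))
    · obtain ⟨i, -, hi⟩ := exists_isFirstViolated h'
      rw [switchField_of_notMem h', hi]
      refine (hN i _ (hmem t)).trans ?_
      exact (Finset.single_le_sum (fun i _ => hN0 i) (Finset.mem_univ i)).trans
        (le_add_of_nonneg_left hM0)

end Data

namespace Data

variable {p m : ℕ} {Ω : Type*}

/-! ### Measurability of the run -/

section Measurability

variable [MeasurableSpace Ω]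

lemma measurable_comp_nat {E : Type*} [MeasurableSpace E] {f : ℕ → Ω → E}
    (hf : ∀ n, Measurable (f n)) {n : Ω → ℕ} (hn : Measurable n) :
    Measurable fun ω => f (n ω) ω :=
  (measurable_from_prod_countable_right (f := fun x : ℕ × Ω => f x.1 x.2) hf).comp
    (hn.prodMk measurable_id)

lemma measurableSet_feasible {q : Fin m → Vec p → ℝ} (hq : ∀ i, ContDiff ℝ 1 (q i)) :
    MeasurableSet (feasible q) := by
  have : feasible q = ⋂ i, {θ | q i θ ≤ 0} := by ext; simp [feasible]
  rw [this]
  exact MeasurableSet.iInter fun i => measurableSet_le (hq i).continuous.measurable measurable_const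

lemma measurable_constraintGrad {q : Fin m → Vec p → ℝ} (hq : ∀ i, ContDiff ℝ 1 (q i)) :
    Measurable (constraintGrad q) := by
  classical
  unfold constraintGrad
  refine Finset.measurable_sum _ fun i _ => ?_
  refine Measurable.ite ?_ (continuous_gradient (hq i)).measurable measurable_const
  have : {θ | IsFirstViolated q θ i} = {θ | 0 < q i θ} ∩ ⋂ j, ⋂ (_ : j < i), {θ | q j θ ≤ 0} := by
    ext; simp [IsFirstViolated]
  rw [this]
  exact (measurableSet_lt measurable_const (hq i).continuous.measurable).inter
    (MeasurableSet.iInter fun j => MeasurableSet.iInter fun _ =>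
      measurableSet_le (hq j).continuous.measurable measurable_const)

variable {D : Data p m Ω}

lemma measurable_gradEstimate (hL : ContDiff ℝ 1 D.L) (hΔ : ∀ k, Measurable (D.Δ k))
    (hε : ∀ k, Measurable fun ω => D.εp k ω - D.εm k ω) (k : ℕ) {θ : Ω → Vec p}
    (hθ : Measurable θ) : Measurable fun ω => D.gradEstimate k (θ ω) ω := by
  refine (WithLp.measurable_toLp 2 (Fin p → ℝ)).comp (measurable_pi_iff.2 fun j => ?_)
  have h1 : Measurable fun ω => D.L (θ ω + D.gainC k • D.Δ k ω) :=
    hL.continuous.measurable.comp (hθ.add ((hΔ k).fun_const_smul _))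
  have h2 : Measurable fun ω => D.L (θ ω - D.gainC k • D.Δ k ω) :=
    hL.continuous.measurable.comp (hθ.sub ((hΔ k).fun_const_smul _))
  have h3 : Measurable fun ω => D.Δ k ω j :=
    (EuclideanSpace.proj (𝕜 := ℝ) j).continuous.measurable.comp (hΔ k)
  have h4 : Measurable fun ω => ((D.L (θ ω + D.gainC k • D.Δ k ω) -
      D.L (θ ω - D.gainC k • D.Δ k ω)) + (D.εp k ω - D.εm k ω)) / (2 * D.gainC k * D.Δ k ω j) :=
    ((h1.sub h2).add (hε k)).div (h3.const_mul _)
  refine (congrArg Measurable (funext fun ω => ?_)).mpr h4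
  ring

/-- Only the difference of the errors is assumed measurable, since the history need not contain the
two errors separately. -/
lemma measurable_state (hL : ContDiff ℝ 1 D.L) (hq : ∀ i, ContDiff ℝ 1 (D.q i))
    (hΔ : ∀ k, Measurable (D.Δ k)) (hε : ∀ k, Measurable fun ω => D.εp k ω - D.εm k ω) (t : ℕ) :
    Measurable (D.iterate t) ∧ Measurable (fun ω => D.spsaCount ω t) ∧
      Measurable (fun ω => D.innerCount ω t) := by
  classical
  induction t with
  | zero => exact ⟨measurable_const, measurable_const, measurable_const⟩
  | succ t ih =>
    obtain ⟨h1, h2, h3⟩ := ih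
    have hset : MeasurableSet {ω | D.FeasibleAt ω t} := h1 (measurableSet_feasible hq)
    have hk : Measurable fun ω => D.kappa t ω := by
      have : (fun ω => D.kappa t ω) =
          fun ω => if D.FeasibleAt ω t then D.spsaCount ω t else D.spsaCount ω t - 1 := by
        funext ω
        split_ifs with h
        · exact kappa_of_feasible h
        · exact kappa_of_not_feasible h
      rw [this]
      exact Measurable.ite hset h2 (h2.sub_const 1)
    refine ⟨?_, ?_, ?_⟩
    · have e : D.iterate (t + 1) = fun ω => if D.FeasibleAt ω t then
          D.iterate t ω - D.gainA (D.spsaCount ω t) •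
            D.gradEstimate (D.spsaCount ω t) (D.iterate t ω) ω
          else D.iterate t ω - D.innerGain (D.kappa t ω) (D.innerCount ω t) •
            constraintGrad D.q (D.iterate t ω) := by
        funext ω
        split_ifs with h
        · exact iterate_succ_of_feasible h
        · exact iterate_succ_of_not_feasible h
      rw [e]
      refine Measurable.ite hset (h1.sub ?_) (h1.sub ?_)
      · exact measurable_comp_nat (f := fun n ω => D.gainA n • D.gradEstimate n (D.iterate t ω) ω)
          (fun n => (measurable_gradEstimate hL hΔ hε n h1).fun_const_smul _) h2
      · have hg : Measurable fun x : ℕ × ℕ => D.innerGain x.1 x.2 := measurable_of_countable _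
        exact (hg.comp (hk.prodMk h3)).smul ((measurable_constraintGrad hq).comp h1)
    · have e : (fun ω => D.spsaCount ω (t + 1)) =
          fun ω => if D.FeasibleAt ω t then D.spsaCount ω t + 1 else D.spsaCount ω t := by
        funext ω
        split_ifs with h
        · exact spsaCount_succ_of_feasible h
        · exact spsaCount_succ_of_not_feasible h
      rw [e]
      exact Measurable.ite hset (h2.add_const 1) h2
    · have e : (fun ω => D.innerCount ω (t + 1)) =
          fun ω => if D.FeasibleAt ω t then 0 else D.innerCount ω t + 1 := by
        funext ω
        split_ifs with h
        · exact innerCount_succ_of_feasible h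
        · exact innerCount_succ_of_not_feasible h
      rw [e]
      exact Measurable.ite hset measurable_const (h3.add_const 1)

end Measurability

/-! ### The point of the `k`-th SPSA step as a function of the history -/

/-- The data with the noise switched off from the `k`-th SPSA step on. -/
def trunc (D : Data p m Ω) (k : ℕ) : Data p m Ω :=
  { D with
    Δ := fun j ω => if j < k then D.Δ j ω else 0
    -- The estimate depends on the errors only through their difference; stored this way, the
    -- truncated data are functions of the history.
    εp := fun j ω => if j < k then D.εp j ω - D.εm j ω else 0
    εm := fun _ _ => 0 }

variable {D : Data p m Ω} {ω : Ω}

lemma gradEstimate_trunc {k j : ℕ} (hj : j < k) (θ : Vec p) :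
    (D.trunc k).gradEstimate j θ ω = D.gradEstimate j θ ω := by
  have h : ∀ x y : ℝ, x + (D.εp j ω - D.εm j ω) - (y + 0) = x + D.εp j ω - (y + D.εm j ω) := by
    intro x y; ring
  simp only [gradEstimate, trunc, if_pos hj, h]
  rfl

/-- A run that has made at most `k` SPSA steps has used only noise of index below `k`. -/
lemma state_trunc {k t : ℕ} (h : D.spsaCount ω t ≤ k) :
    (D.trunc k).state ω t = D.state ω t := by
  induction t with
  | zero => rfl
  | succ t ih =>
    have h1 := ih ((spsaCount_mono (Nat.le_succ t)).trans h)
    change (D.trunc k).step ω ((D.trunc k).state ω t) = D.step ω (D.state ω t)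
    rw [h1]
    by_cases hf : D.FeasibleAt ω t
    · have hf' : (D.state ω t).pt ∈ feasible D.q := hf
      rw [spsaCount_succ_of_feasible hf] at h
      have hc : D.counter (D.state ω t) = D.spsaCount ω t := kappa_of_feasible hf
      rw [D.step_of_mem ω hf', (D.trunc k).step_of_mem ω hf']
      change State.mk (_ - D.gainA (D.counter (D.state ω t)) •
        (D.trunc k).gradEstimate (D.counter (D.state ω t)) _ ω) _ _ = _
      rw [gradEstimate_trunc (by omega)]
    · have hf' : (D.state ω t).pt ∉ feasible D.q := hf
      rw [D.step_of_notMem ω hf', (D.trunc k).step_of_notMem ω hf']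
      rfl

/-- Step `t` is the `k`-th SPSA step of the truncated run, or there is no such step. -/
def IsSpsaTime (D : Data p m Ω) (k : ℕ) (ω : Ω) (t : ℕ) : Prop :=
  ((D.trunc k).FeasibleAt ω t ∧ (D.trunc k).spsaCount ω t = k) ∨
    ∀ s, ¬ ((D.trunc k).FeasibleAt ω s ∧ (D.trunc k).spsaCount ω s = k)

lemma exists_isSpsaTime (D : Data p m Ω) (k : ℕ) (ω : Ω) : ∃ t, D.IsSpsaTime k ω t := by
  by_cases h : ∃ t, (D.trunc k).FeasibleAt ω t ∧ (D.trunc k).spsaCount ω t = k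
  · exact h.imp fun t ht => Or.inl ht
  · exact ⟨0, Or.inr (not_exists.1 h)⟩

open Classical in
/-- The point at which the `k`-th SPSA step is made. -/
def spsaPoint (D : Data p m Ω) (k : ℕ) (ω : Ω) : Vec p :=
  (D.trunc k).iterate (Nat.find (D.exists_isSpsaTime k ω)) ω

/-- Up to step `t` the truncated and true runs agree, and no earlier step qualifies, since a
feasible step with count `k` would have raised the count. -/
lemma spsaPoint_spsaCount {t : ℕ} (h : D.FeasibleAt ω t) :
    D.spsaPoint (D.spsaCount ω t) ω = D.iterate t ω := by
  classical
  set k := D.spsaCount ω t with hk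
  have htr : ∀ s ≤ t, (D.trunc k).state ω s = D.state ω s := fun s hs =>
    state_trunc (spsaCount_mono hs)
  have ht : (D.trunc k).FeasibleAt ω t ∧ (D.trunc k).spsaCount ω t = k := by
    constructor
    · change ((D.trunc k).state ω t).pt ∈ feasible D.q
      rw [htr t le_rfl]
      exact h
    · change ((D.trunc k).state ω t).count = k
      rw [htr t le_rfl]
      rfl
  have hfind : Nat.find (D.exists_isSpsaTime k ω) = t := by
    refine (Nat.find_eq_iff _).2 ⟨Or.inl ht, fun s hs hs' => ?_⟩
    rcases hs' with ⟨h1, h2⟩ | h1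
    · change ((D.trunc k).state ω s).pt ∈ feasible D.q at h1
      change ((D.trunc k).state ω s).count = k at h2
      rw [htr s hs.le] at h1 h2
      have h3 : D.spsaCount ω (s + 1) = D.spsaCount ω s + 1 := spsaCount_succ_of_feasible h1
      have h4 := spsaCount_mono (D := D) (ω := ω) (Nat.succ_le_of_lt hs)
      have h5 : D.spsaCount ω s = k := h2
      rw [Nat.succ_eq_add_one] at h4
      omega
    · exact h1 t ht
  rw [spsaPoint, hfind]
  change ((D.trunc k).state ω t).pt = _
  rw [htr t le_rfl]
  rfl

/-- Stated for any σ-algebra on `Ω`, to be applied with the history in place of the ambient one. -/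
lemma measurable_spsaPoint_of_measurable [MeasurableSpace Ω] (hL : ContDiff ℝ 1 D.L)
    (hq : ∀ i, ContDiff ℝ 1 (D.q i)) {k : ℕ} (hΔ : ∀ j < k, Measurable (D.Δ j))
    (hε : ∀ j < k, Measurable fun ω => D.εp j ω - D.εm j ω) : Measurable (D.spsaPoint k) := by
  classical
  have hΔ' : ∀ j, Measurable ((D.trunc k).Δ j) := by
    intro j
    by_cases hj : j < k
    · simpa [trunc, hj] using hΔ j hj
    · simp [trunc, hj]
  have hε' : ∀ j, Measurable fun ω => (D.trunc k).εp j ω - (D.trunc k).εm j ω := by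
    intro j
    by_cases hj : j < k
    · simpa [trunc, hj] using hε j hj
    · simp [trunc, hj]
  have hst := measurable_state (D := D.trunc k) hL hq hΔ' hε'
  have hset : ∀ s, MeasurableSet
      {ω | (D.trunc k).FeasibleAt ω s ∧ (D.trunc k).spsaCount ω s = k} := fun s =>
    ((hst s).1 (measurableSet_feasible hq)).inter ((hst s).2.1 (measurableSet_singleton k))
  have htime : Measurable fun ω => Nat.find (D.exists_isSpsaTime k ω) := by
    refine measurable_find _ fun t => ?_
    refine (hset t).union ?_
    have : {ω | ∀ s, ¬ ((D.trunc k).FeasibleAt ω s ∧ (D.trunc k).spsaCount ω s = k)} =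
        ⋂ s, {ω | (D.trunc k).FeasibleAt ω s ∧ (D.trunc k).spsaCount ω s = k}ᶜ := by
      ext; simp
    change MeasurableSet {ω | ∀ s, ¬ ((D.trunc k).FeasibleAt ω s ∧ (D.trunc k).spsaCount ω s = k)}
    rw [this]
    exact MeasurableSet.iInter fun s => (hset s).compl
  exact measurable_comp_nat (fun t => (hst t).1) htime

lemma measurable_Δ_history (D : Data p m Ω) {j k : ℕ} (hj : j < k) :
    Measurable[D.history k] (D.Δ j) :=
  measurable_iff_comap_le.2 ((le_sup_left).trans
    (le_iSup (fun j : Fin k => MeasurableSpace.comap (D.Δ j) inferInstance ⊔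
      MeasurableSpace.comap (fun ω => D.εp j ω - D.εm j ω) inferInstance) ⟨j, hj⟩))

lemma measurable_noise_history (D : Data p m Ω) {j k : ℕ} (hj : j < k) :
    Measurable[D.history k] fun ω => D.εp j ω - D.εm j ω :=
  measurable_iff_comap_le.2 ((le_sup_right).trans
    (le_iSup (fun j : Fin k => MeasurableSpace.comap (D.Δ j) inferInstance ⊔
      MeasurableSpace.comap (fun ω => D.εp j ω - D.εm j ω) inferInstance) ⟨j, hj⟩))

/-- The histories form a filtration. -/
def historyFiltration [mΩ : MeasurableSpace Ω] (hD : D.Standing) : Filtration ℕ mΩ where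
  seq := D.history
  mono' := by
    intro k l hkl
    refine iSup_le fun j => sup_le ?_ ?_
    · exact measurable_iff_comap_le.1 (D.measurable_Δ_history (j.2.trans_le hkl))
    · exact measurable_iff_comap_le.1 (D.measurable_noise_history (j.2.trans_le hkl))
  le' := by
    intro k
    refine iSup_le fun j => sup_le ?_ ?_
    · exact measurable_iff_comap_le.1 (hD.measurable_Δ j)
    · exact measurable_iff_comap_le.1 ((hD.measurable_εp j).sub (hD.measurable_εm j))

lemma measurable_spsaPoint [MeasurableSpace Ω] (hD : D.Standing) (k : ℕ) :
    Measurable[D.history k] (D.spsaPoint k) :=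
  @measurable_spsaPoint_of_measurable p m Ω D (D.history k) hD.contDiff_L hD.contDiff_q k
    (fun _ hj => D.measurable_Δ_history hj) (fun _ hj => D.measurable_noise_history hj)

end Data

/-! ### Moment bounds and conditional means -/

section Moments

variable {Ω : Type*} [MeasurableSpace Ω] {μ : Measure Ω}

lemma memLp_two_of_lintegral_le {f : Ω → ℝ} (hf : AEStronglyMeasurable f μ) {K : ℝ} (hK : 0 ≤ K)
    (h : ∫⁻ ω, ‖f ω‖ₑ ^ (2 : ℝ) ∂μ ≤ ENNReal.ofReal K) : MemLp f 2 μ ∧ ∫ ω, f ω ^ 2 ∂μ ≤ K := by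
  constructor
  · refine ⟨hf, ?_⟩
    rw [eLpNorm_lt_top_iff_lintegral_rpow_enorm_lt_top two_ne_zero ENNReal.ofNat_ne_top]
    simpa using h.trans_lt ENNReal.ofReal_lt_top
  · rw [integral_eq_lintegral_of_nonneg_ae (Eventually.of_forall fun ω => sq_nonneg _) (hf.pow 2)]
    refine ENNReal.toReal_le_of_le_ofReal hK ?_
    refine (lintegral_congr fun ω => ?_).trans_le h
    rw [ENNReal.rpow_two, ← ofReal_norm, ← ENNReal.ofReal_pow (norm_nonneg _), Real.norm_eq_abs,
      sq_abs]

lemma integrable_of_lintegral_rpow_le [IsFiniteMeasure μ] {f : Ω → ℝ}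
    (hf : AEStronglyMeasurable f μ) {δ K : ℝ} (hδ : 0 < δ)
    (h : ∫⁻ ω, ‖f ω‖ₑ ^ (2 + δ) ∂μ ≤ ENNReal.ofReal K) : Integrable f μ := by
  have h1 : MemLp f (ENNReal.ofReal (2 + δ)) μ := by
    refine ⟨hf, ?_⟩
    rw [eLpNorm_lt_top_iff_lintegral_rpow_enorm_lt_top (by simp; linarith) ENNReal.ofReal_ne_top,
      ENNReal.toReal_ofReal (by linarith)]
    exact h.trans_lt ENNReal.ofReal_lt_top
  refine h1.integrable ?_
  rw [ENNReal.one_le_ofReal]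
  linarith

/-- A negative power is infinite at zero, which a finite integral allows only on a null set. -/
lemma ae_ne_zero_of_lintegral_rpow_neg_le {f : Ω → ℝ} (hf : Measurable f) {s K : ℝ} (hs : 0 < s)
    (h : ∫⁻ ω, ‖f ω‖ₑ ^ (-s) ∂μ ≤ ENNReal.ofReal K) : ∀ᵐ ω ∂μ, f ω ≠ 0 := by
  filter_upwards [ae_lt_top (hf.enorm.pow_const _) (h.trans_lt ENNReal.ofReal_lt_top).ne]
    with ω h1 h2
  rw [h2, enorm_zero, ENNReal.zero_rpow_of_neg (by linarith)] at h1
  exact lt_irrefl _ h1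

/-- The larger exponent dominates where the inverse is at least one in size, and `1` dominates
elsewhere; at zero the inverse is zero by convention. -/
lemma enorm_inv_sq_le (x : ℝ) {δ : ℝ} (hδ : 0 < δ) :
    ‖x⁻¹‖ₑ ^ (2 : ℝ) ≤ 1 + ‖x‖ₑ ^ (-(2 + δ)) := by
  by_cases hx : x = 0
  · simp [hx]
  · rw [ENNReal.rpow_neg, ← ENNReal.inv_rpow, enorm_inv hx]
    rcases le_total ‖x‖ₑ⁻¹ 1 with h | h
    · exact (ENNReal.rpow_le_one h (by norm_num)).trans le_self_add
    · exact (ENNReal.rpow_le_rpow_of_exponent_le h (by linarith)).trans le_add_self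

variable [IsProbabilityMeasure μ]

lemma memLp_inv_of_lintegral_le {f : Ω → ℝ} (hf : Measurable f) {δ K : ℝ} (hδ : 0 < δ)
    (hK : 0 < K) (h : ∫⁻ ω, ‖f ω‖ₑ ^ (-(2 + δ)) ∂μ ≤ ENNReal.ofReal K) :
    MemLp (fun ω => (f ω)⁻¹) 2 μ ∧ ∫ ω, (f ω)⁻¹ ^ 2 ∂μ ≤ 1 + K := by
  refine memLp_two_of_lintegral_le hf.inv.aestronglyMeasurable (by linarith) ?_
  refine (lintegral_mono fun ω => enorm_inv_sq_le (f ω) hδ).trans ?_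
  rw [lintegral_add_left measurable_const, lintegral_const, measure_univ, mul_one,
    ENNReal.ofReal_add zero_le_one hK.le, ENNReal.ofReal_one]
  gcongr

/-- Centering a nonnegative square-integrable variable. -/
lemma integral_sub_mean_sq_le {u : Ω → ℝ} (hu : MemLp u 2 μ) {K : ℝ}
    (hK : ∫ ω, u ω ^ 2 ∂μ ≤ K) :
    ∫ ω, u ω ∂μ ≤ 1 + K ∧ ∫ ω, (u ω - ∫ ω', u ω' ∂μ) ∂μ = 0 ∧
      ∫ ω, (u ω - ∫ ω', u ω' ∂μ) ^ 2 ∂μ ≤ K := by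
  have hi := hu.integrable one_le_two
  refine ⟨?_, ?_, ?_⟩
  · have h1 : ∫ ω, u ω ∂μ ≤ ∫ ω, (1 + u ω ^ 2) ∂μ := by
      refine integral_mono hi ((integrable_const _).add hu.integrable_sq) fun ω => ?_
      change u ω ≤ 1 + u ω ^ 2
      nlinarith [sq_nonneg (u ω - 1), sq_nonneg (u ω)]
    rw [integral_add (integrable_const _) hu.integrable_sq] at h1
    simp only [integral_const, probReal_univ, smul_eq_mul, one_mul] at h1
    linarith
  · rw [integral_sub hi (integrable_const _)]
    simp
  · have h1 := variance_le_expectation_sq hu.1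
    rw [variance_eq_integral hu.1.aemeasurable] at h1
    exact h1.trans hK

/-- A variable with conditional mean zero, divided by a known one, has conditional mean zero. -/
lemma condExp_div_eq_zero {Ω : Type*} {m₁ m₂ mΩ : MeasurableSpace Ω} {μ : Measure Ω}
    [IsFiniteMeasure μ] (h₁₂ : m₁ ≤ m₂) (hle : m₂ ≤ mΩ) {e x : Ω → ℝ}
    (hx : StronglyMeasurable[m₂] fun ω => (x ω)⁻¹) (he : Integrable e μ)
    (hint : Integrable (fun ω => e ω / x ω) μ) (h : μ[e | m₂] =ᵐ[μ] 0) :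
    μ[fun ω => e ω / x ω | m₁] =ᵐ[μ] 0 := by
  have hprod : (fun ω => e ω / x ω) = (fun ω => (x ω)⁻¹) * e := by
    funext ω
    rw [Pi.mul_apply, div_eq_inv_mul]
  have h1 := condExp_mul_of_stronglyMeasurable_left (μ := μ) hx (hprod ▸ hint) he
  rw [← hprod] at h1
  have h2 : μ[fun ω => e ω / x ω | m₂] =ᵐ[μ] 0 := by
    filter_upwards [h1, h] with ω e1 e2
    rw [e1, Pi.mul_apply, e2, Pi.zero_apply, mul_zero]
  have e1 := condExp_condExp_of_le (μ := μ) (f := fun ω => e ω / x ω) h₁₂ hle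
  have e2 := condExp_congr_ae (m := m₁) h2
  rw [condExp_zero] at e2
  exact e1.symm.trans e2

end Moments

/-! ### Almost sure negligibility of the estimation errors -/

namespace Data

variable {p m : ℕ} {Ω : Type*} {D : Data p m Ω}

lemma measurable_Δ_apply [MeasurableSpace Ω] (hD : D.Standing) (k : ℕ) (j : Fin p) :
    Measurable fun ω => D.Δ k ω j :=
  (EuclideanSpace.proj (𝕜 := ℝ) j).continuous.measurable.comp (hD.measurable_Δ k)

lemma measurable_Δ_apply_comap (D : Data p m Ω) (k : ℕ) (j : Fin p) :
    Measurable[MeasurableSpace.comap (D.Δ k) inferInstance] fun ω => D.Δ k ω j :=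
  (EuclideanSpace.proj (𝕜 := ℝ) j).continuous.measurable.comp (comap_measurable (D.Δ k))

lemma comap_Δ_le_history (D : Data p m Ω) (k : ℕ) :
    MeasurableSpace.comap (D.Δ k) inferInstance ≤ D.history (k + 1) :=
  measurable_iff_comap_le.1 (D.measurable_Δ_history (Nat.lt_succ_self k))

variable [mΩ : MeasurableSpace Ω] {μ : Measure Ω}

lemma summable_gainA_sq (hgain : D.GainCondition μ) : Summable fun k => D.gainA k ^ 2 := by
  refine Summable.of_norm_bounded_eventually_nat hgain.summable_sq ?_
  filter_upwards [hgain.gainC_tendsto.eventually_lt_const one_pos] with k hk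
  have hc := hgain.gainC_pos k
  rw [Real.norm_of_nonneg (sq_nonneg _), le_div_iff₀ (by positivity)]
  have : D.gainC k ^ 2 ≤ 1 := pow_le_one₀ hc.le hk.le
  nlinarith [sq_nonneg (D.gainA k)]

/-- Ratios of different coordinates of a perturbation are centered. -/
lemma integral_ratio_eq_zero (hpert : D.PerturbationCondition μ) (hD : D.Standing) (k : ℕ)
    {i j : Fin p} (hij : i ≠ j) : ∫ ω, D.Δ k ω i / D.Δ k ω j ∂μ = 0 := by
  have h1 : IndepFun (fun ω => D.Δ k ω i) (fun ω => (D.Δ k ω j)⁻¹) μ :=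
    (hpert.indep.indepFun (i := (k, i)) (j := (k, j)) (by simpa using hij)).comp
      measurable_id measurable_inv
  have h2 : ∫ ω, D.Δ k ω i ∂μ = 0 := by
    have := (hpert.symm k i).integral_eq
    rw [integral_neg] at this
    linarith
  simp only [div_eq_mul_inv]
  rw [h1.integral_fun_mul_eq_mul_integral (measurable_Δ_apply hD k i).aestronglyMeasurable
    (measurable_Δ_apply hD k j).inv.aestronglyMeasurable, h2, zero_mul]

lemma memLp_ratio (hD : D.Standing) {k : ℕ} {i j : Fin p} {α₂ K : ℝ}
    (hα₂ : ∀ᵐ ω ∂μ, |D.Δ k ω i| ≤ α₂)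
    (hinv : MemLp (fun ω => (D.Δ k ω j)⁻¹) 2 μ) (hK : ∫ ω, (D.Δ k ω j)⁻¹ ^ 2 ∂μ ≤ K) :
    MemLp (fun ω => D.Δ k ω i / D.Δ k ω j) 2 μ ∧
      ∫ ω, (D.Δ k ω i / D.Δ k ω j) ^ 2 ∂μ ≤ α₂ ^ 2 * K := by
  have h1 : MemLp (fun ω => D.Δ k ω i / D.Δ k ω j) 2 μ := by
    refine hinv.of_le_mul (c := α₂) ((measurable_Δ_apply hD k i).div
      (measurable_Δ_apply hD k j)).aestronglyMeasurable ?_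
    filter_upwards [hα₂] with ω hω
    rw [div_eq_mul_inv, norm_mul]
    exact mul_le_mul_of_nonneg_right hω (norm_nonneg _)
  refine ⟨h1, ?_⟩
  have h2 : ∫ ω, (D.Δ k ω i / D.Δ k ω j) ^ 2 ∂μ ≤ ∫ ω, α₂ ^ 2 * (D.Δ k ω j)⁻¹ ^ 2 ∂μ := by
    refine integral_mono_ae h1.integrable_sq (hinv.integrable_sq.const_mul _) ?_
    filter_upwards [hα₂] with ω hω
    have : D.Δ k ω i ^ 2 ≤ α₂ ^ 2 := sq_le_sq' (abs_le.1 hω).1 (abs_le.1 hω).2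
    change (D.Δ k ω i / D.Δ k ω j) ^ 2 ≤ α₂ ^ 2 * (D.Δ k ω j)⁻¹ ^ 2
    rw [div_eq_mul_inv, mul_pow]
    exact mul_le_mul_of_nonneg_right this (sq_nonneg _)
  rw [integral_const_mul] at h2
  exact h2.trans (mul_le_mul_of_nonneg_left hK (sq_nonneg _))

variable [IsProbabilityMeasure μ]

/-- The measurement error part of the gradient estimate is a convergent martingale. -/
lemma ae_tendsto_sum_noise (hD : D.Standing) (hgain : D.GainCondition μ)
    (hnoise : D.NoiseCentered μ) {δ α₀ α₄ : ℝ} (hδ : 0 < δ) (h4 : 0 < α₄)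
    (hε : ∀ k, ∫⁻ ω, ‖D.εp k ω‖ₑ ^ (2 + δ) ∂μ ≤ ENNReal.ofReal α₀ ∧
      ∫⁻ ω, ‖D.εm k ω‖ₑ ^ (2 + δ) ∂μ ≤ ENNReal.ofReal α₀) (j : Fin p)
    (hα₄ : ∀ k, ∫⁻ ω, ‖D.εp k ω / D.Δ k ω j‖ₑ ^ (2 : ℝ) ∂μ ≤ ENNReal.ofReal α₄ ∧
      ∫⁻ ω, ‖D.εm k ω / D.Δ k ω j‖ₑ ^ (2 : ℝ) ∂μ ≤ ENNReal.ofReal α₄) :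
    ∀ᵐ ω ∂μ, ∃ l, Tendsto (fun n => ∑ k ∈ Finset.range n,
      D.gainA k / (2 * D.gainC k) * ((D.εp k ω - D.εm k ω) / D.Δ k ω j)) atTop (𝓝 l) := by
  have hΔm := fun k => measurable_Δ_apply hD k j
  have hp := fun k => memLp_two_of_lintegral_le (f := fun ω => D.εp k ω / D.Δ k ω j)
    ((hD.measurable_εp k).div (hΔm k)).aestronglyMeasurable h4.le (hα₄ k).1
  have hm := fun k => memLp_two_of_lintegral_le (f := fun ω => D.εm k ω / D.Δ k ω j)
    ((hD.measurable_εm k).div (hΔm k)).aestronglyMeasurable h4.le (hα₄ k).2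
  have hX : ∀ k, MemLp (fun ω => (D.εp k ω - D.εm k ω) / D.Δ k ω j) 2 μ := by
    intro k
    have := (hp k).1.sub (hm k).1
    refine (congrArg (fun f => MemLp f 2 μ) (funext fun ω => ?_)).mpr this
    exact sub_div _ _ _
  have hXB : ∀ k, ∫ ω, ((D.εp k ω - D.εm k ω) / D.Δ k ω j) ^ 2 ∂μ ≤ 4 * α₄ := by
    intro k
    have h1 : ∫ ω, ((D.εp k ω - D.εm k ω) / D.Δ k ω j) ^ 2 ∂μ ≤
        ∫ ω, (2 * (D.εp k ω / D.Δ k ω j) ^ 2 + 2 * (D.εm k ω / D.Δ k ω j) ^ 2) ∂μ := by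
      refine integral_mono (hX k).integrable_sq (((hp k).1.integrable_sq.const_mul 2).add
        ((hm k).1.integrable_sq.const_mul 2)) fun ω => ?_
      change ((D.εp k ω - D.εm k ω) / D.Δ k ω j) ^ 2 ≤ _
      rw [sub_div]
      nlinarith [sq_nonneg (D.εp k ω / D.Δ k ω j + D.εm k ω / D.Δ k ω j)]
    rw [integral_add ((hp k).1.integrable_sq.const_mul 2) ((hm k).1.integrable_sq.const_mul 2),
      integral_const_mul, integral_const_mul] at h1
    linarith [(hp k).2, (hm k).2]
  refine ae_tendsto_sum_of_martingale_difference (historyFiltration hD)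
    (v := fun k => α₄ * (D.gainA k ^ 2 / D.gainC k ^ 2)) (fun k => ?_)
    (fun k => (hX k).const_mul _) (fun k => ?_) (fun k => ?_) (hgain.summable_sq.mul_left _)
  · have h1 : Measurable[D.history (k + 1)] fun ω => D.Δ k ω j :=
      (D.measurable_Δ_apply_comap k j).mono (D.comap_Δ_le_history k) le_rfl
    have h2 := (D.measurable_noise_history (Nat.lt_succ_self k)).div h1
    exact (h2.const_mul (D.gainA k / (2 * D.gainC k))).stronglyMeasurable
  · have hle : D.history k ⊔ MeasurableSpace.comap (D.Δ k) inferInstance ≤ mΩ :=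
      sup_le ((historyFiltration hD).le k) (measurable_iff_comap_le.1 (hD.measurable_Δ k))
    have hinv : Measurable[D.history k ⊔ MeasurableSpace.comap (D.Δ k) inferInstance]
        fun ω => (D.Δ k ω j)⁻¹ :=
      measurable_inv.comp ((D.measurable_Δ_apply_comap k j).mono le_sup_right le_rfl)
    have he : Integrable (fun ω => D.εp k ω - D.εm k ω) μ :=
      (integrable_of_lintegral_rpow_le (hD.measurable_εp k).aestronglyMeasurable hδ (hε k).1).sub
        (integrable_of_lintegral_rpow_le (hD.measurable_εm k).aestronglyMeasurable hδ (hε k).2)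
    -- Conditioning on the history and `Δ_k` together makes `1 / Δ_kj` known; the tower property
    -- then descends to the history.
    have h3 := condExp_div_eq_zero le_sup_left hle hinv.stronglyMeasurable he
      ((hX k).integrable one_le_two) (hnoise k)
    have h5 := condExp_smul (μ := μ) (D.gainA k / (2 * D.gainC k))
      (fun ω => (D.εp k ω - D.εm k ω) / D.Δ k ω j) (D.history k)
    refine EventuallyEq.trans h5 ?_
    filter_upwards [h3] with ω e
    rw [Pi.smul_apply, e, Pi.zero_apply, smul_zero]
  · simp only [mul_pow]
    rw [integral_const_mul]
    refine (mul_le_mul_of_nonneg_left (hXB k) (sq_nonneg _)).trans (le_of_eq ?_)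
    have := (hgain.gainC_pos k).ne'
    field_simp
    ring

/-- Almost surely, the errors of the gradient estimates along a bounded run are negligible. -/
lemma ae_negligibleSum (hD : D.Standing) (hgain : D.GainCondition μ)
    (hpert : D.PerturbationCondition μ) (hnoise : D.NoiseCentered μ) (hmom : D.MomentCondition μ) :
    ∀ᵐ ω ∂μ, ∀ R : ℝ, (∀ k, ‖D.spsaPoint k ω‖ ≤ R) → NegligibleSum D.gainA (fun k =>
      D.gainA k • (D.gradEstimate k (D.spsaPoint k ω) ω - gradient D.L (D.spsaPoint k ω))) := by
  classical
  obtain ⟨δ, α₀, -, α₂, α₃, α₄, hδ, -, -, h2, h3, h4, hε, -, hα₂, hα₃, hα₄⟩ := hmom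
  have hΔm := fun k j => measurable_Δ_apply hD k j
  have hinv := fun k j => memLp_inv_of_lintegral_le (hΔm k j) hδ h3 (hα₃ k j)
  have habs : ∀ k j, MemLp (fun ω => |D.Δ k ω j|⁻¹) 2 μ := fun k j => by
    simpa using (hinv k j).1.norm
  have hsq := summable_gainA_sq hgain
  -- The martingale lemma needs a bound uniform in `ω`, whereas the bound on the run depends on `ω`.
  -- Hence a cutoff at every integer `N`, inactive once `N ≥ R`.
  have hcross : ∀ᵐ ω ∂μ, ∀ (N : ℕ) (j i : Fin p), i ≠ j → ∃ l, Tendsto (fun n =>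
      ∑ k ∈ Finset.range n, D.gainA k * ((if ‖D.spsaPoint k ω‖ ≤ N then
        gradient D.L (D.spsaPoint k ω) i else 0) * (D.Δ k ω i / D.Δ k ω j))) atTop (𝓝 l) := by
    refine ae_all_iff.2 fun N => ae_all_iff.2 fun j => ae_all_iff.2 fun i => ?_
    by_cases hij : i = j
    · exact Eventually.of_forall fun ω h => absurd hij h
    obtain ⟨M, hM⟩ := (isCompact_closedBall (0 : Vec p) N).exists_bound_of_continuousOn
      (continuous_gradient hD.contDiff_L).continuousOn
    have hM0 : 0 ≤ M := (norm_nonneg _).trans (hM 0 (by simp))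
    have := ae_tendsto_sum_of_fresh (μ := μ) (historyFiltration hD) (a := D.gainA)
      (G := fun k ω => if ‖D.spsaPoint k ω‖ ≤ N then gradient D.L (D.spsaPoint k ω) i else 0)
      (X := fun k ω => D.Δ k ω i / D.Δ k ω j) (𝒢 := fun k =>
        MeasurableSpace.comap (D.Δ k) inferInstance) D.comap_Δ_le_history hpert.fresh
      (fun k => ((D.measurable_Δ_apply_comap k i).div
        (D.measurable_Δ_apply_comap k j)).stronglyMeasurable)
      (fun k => (memLp_ratio hD (hα₂ k i) (hinv k j).1 (hinv k j).2).1)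
      (fun k => integral_ratio_eq_zero hpert hD k hij)
      (fun k => (memLp_ratio hD (hα₂ k i) (hinv k j).1 (hinv k j).2).2)
      (fun k => by
        have h5 : Measurable fun x : Vec p =>
            if ‖x‖ ≤ (N : ℝ) then gradient D.L x i else 0 :=
          Measurable.ite (measurableSet_le measurable_norm measurable_const)
            ((EuclideanSpace.proj (𝕜 := ℝ) i).continuous.comp
              (continuous_gradient hD.contDiff_L)).measurable measurable_const
        exact (h5.comp (measurable_spsaPoint hD k)).stronglyMeasurable)
      (M := M) (fun k ω => by
        split_ifs with h
        · exact (PiLp.norm_apply_le _ i).trans (hM _ (by simpa using h))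
        · simpa using hM0) hsq
    filter_upwards [this] with ω hω _
    exact hω
  have hinvsum : ∀ᵐ ω ∂μ, ∀ j : Fin p, ∃ l, Tendsto (fun n => ∑ k ∈ Finset.range n,
      D.gainA k * (1 * (|D.Δ k ω j|⁻¹ - ∫ ω', |D.Δ k ω' j|⁻¹ ∂μ))) atTop (𝓝 l) := by
    refine ae_all_iff.2 fun j => ?_
    have hc := fun k => integral_sub_mean_sq_le (u := fun ω => |D.Δ k ω j|⁻¹) (μ := μ)
      (habs k j) (by simpa using (hinv k j).2)
    exact ae_tendsto_sum_of_fresh (μ := μ) (historyFiltration hD) (a := D.gainA)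
      (G := fun _ _ => 1) (X := fun k ω => |D.Δ k ω j|⁻¹ - ∫ ω', |D.Δ k ω' j|⁻¹ ∂μ)
      (𝒢 := fun k => MeasurableSpace.comap (D.Δ k) inferInstance) D.comap_Δ_le_history hpert.fresh
      (fun k => by
        have h5 : Measurable fun x : ℝ => |x|⁻¹ - ∫ ω', |D.Δ k ω' j|⁻¹ ∂μ :=
          (measurable_id.abs.inv).sub_const _
        exact (h5.comp (D.measurable_Δ_apply_comap k j)).stronglyMeasurable)
      (fun k => (habs k j).sub (memLp_const _))
      (fun k => (hc k).2.1) (fun k => (hc k).2.2)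
      (fun k => stronglyMeasurable_const) (M := 1) (fun _ _ => by simp) hsq
  -- The mean is at most one plus the second moment, which is at most `1 + α₃`.
  have hmean : ∀ k j, ∫ ω, |D.Δ k ω j|⁻¹ ∂μ ≤ 1 + (1 + α₃) := fun k j =>
    (integral_sub_mean_sq_le (u := fun ω => |D.Δ k ω j|⁻¹) (μ := μ)
      (habs k j) (by simpa using (hinv k j).2)).1
  have hnoisesum := ae_all_iff.2 fun j : Fin p =>
    ae_tendsto_sum_noise hD hgain hnoise hδ h4 hε j (fun k => hα₄ k j)
  have hne : ∀ᵐ ω ∂μ, ∀ k j, D.Δ k ω j ≠ 0 :=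
    ae_all_iff.2 fun k => ae_all_iff.2 fun j =>
      ae_ne_zero_of_lintegral_rpow_neg_le (hΔm k j) (by linarith) (hα₃ k j)
  have hbd : ∀ᵐ ω ∂μ, ∀ k j, |D.Δ k ω j| ≤ α₂ :=
    ae_all_iff.2 fun k => ae_all_iff.2 fun j => hα₂ k j
  filter_upwards [hcross, hinvsum, hnoisesum, hne, hbd] with ω e1 e2 e3 e4 e5 R hR
  obtain ⟨N, hN⟩ := exists_nat_ge R
  refine negligibleSum_gradEstimate (B := ∑ _j : Fin p, α₂) hD.contDiff_L
    (fun k => (hgain.gainA_pos k).le) hgain.gainC_pos hgain.gainC_tendsto hR e4 (fun k => ?_)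
    (e := fun k j => ∫ ω', |D.Δ k ω' j|⁻¹ ∂μ) hmean (by linarith) (fun j i hij => ?_) e2 e3
  · have h6 := (EuclideanSpace.basisFun (Fin p) ℝ).sum_repr (D.Δ k ω)
    rw [← h6]
    refine norm_sum_le_of_le _ fun j _ => ?_
    rw [norm_smul, OrthonormalBasis.norm_eq_one, mul_one]
    exact e5 k j
  · have := e1 N j i hij
    simpa only [if_pos ((hR _).trans hN)] using this

end Data

end SwitchUpdating

end

theorem proposition3 {p m : ℕ} {Ω : Type*} [MeasurableSpace Ω] (μ : MeasureTheory.Measure Ω)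
    [MeasureTheory.IsProbabilityMeasure μ]
    (D : SwitchUpdating.Data p m Ω) (hD : D.Standing)
    (hα : D.α ∈ Set.Ioo (1 / 2 : ℝ) 1)
    (θs : SwitchUpdating.Vec p)
    (hgain : D.GainCondition μ)
    (hpert : D.PerturbationCondition μ)
    (hnoise : D.NoiseCentered μ)
    (hmom : D.MomentCondition μ)
    (hbdd : D.BoundedIterates μ)
    (hstable : SwitchUpdating.IsAsymptoticallyStable
      (SwitchUpdating.switchField D.L D.q) θs)
    (hrec : D.RecurrentInBasin μ θs)
    (hopt : SwitchUpdating.IsUniqueSolution D.L D.q θs)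
    (lam : Fin m → ℝ) (hKKT : SwitchUpdating.IsKKTWith D.L D.q θs lam)
    (hLICQ : SwitchUpdating.LICQ D.q θs) :
    ∀ᵐ ω ∂μ, Filter.Tendsto (fun t : ℕ => D.measurementProportion t ω) Filter.atTop
      (nhds (1 / (1 + ∑ i, lam i))) := by
  obtain ⟨S, hS, hSb, hrec⟩ := hrec
  filter_upwards [hgain.returns, hbdd, hrec,
    D.ae_negligibleSum hD hgain hpert hnoise hmom] with ω hret hR hrec hneg
  obtain ⟨R, hR⟩ := hR
  have hκ := SwitchUpdating.Data.tendsto_kappa hret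
  -- Every index occurs because `κ` is unbounded, so each `spsaPoint` is a true iterate and inherits
  -- the bound.
  have hpt : ∀ k, ‖D.spsaPoint k ω‖ ≤ R := by
    intro k
    obtain ⟨t, ht, rfl⟩ := SwitchUpdating.Data.exists_spsa_step
      (SwitchUpdating.Data.tendsto_spsaCount hκ) k
    rw [SwitchUpdating.Data.spsaPoint_spsaCount ht]
    exact hR t
  obtain ⟨ζ, C, H⟩ := SwitchUpdating.Data.exists_perturbedEuler hD hgain.gainA_tendsto
    hgain.sum_gainA hκ hR (x := fun k => D.spsaPoint k ω)
    (fun t ht => SwitchUpdating.Data.spsaPoint_spsaCount ht) (hneg R hpt)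
  have hθ := H.tendsto_equilibrium hR hstable hS hSb hrec
  exact SwitchUpdating.Data.tendsto_measurementProportion hD hα hgain.sum_gainA hκ H hθ hKKT hLICQ
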